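/- For a real number $x\ge 0$ with regular continued fraction $x=[a_0,a_1,a_2,\dots]$ (finite or infinite) put $$F(x)=1-2^{-a_0}+2^{-(a_0+a_1)}-2^{-(a_0+a_1+a_2)}+\cdots,$$ and let $?(x)=2F(x)$ for $x\in[0,1]$ be Minkowski's question mark function. For integers $L\ge 0$ define the moments $$m_L=\int_0^1 x^L\,d?(x)=2\int_0^1 x^L\,dF(x)=\int_0^\infty\Big(\frac{x}{x+1}\Big)^L dF(x),$$ the three Lebesgue–Stieltjes integrals being equal. Then, as $L\to\infty$, $$m_L=\sqrt[4]{4\pi^2\log 2}\cdot c_0\cdot L^{1/4}\,C^{\sqrt L}+O\big(L^{-1/4}C^{\sqrt L}\big),\qquad C=e^{-2\sqrt{\log 2}}.$$ Here $c_0=\int_0^1\Psi(x)\,dx=1.030199563382\ldots$ (all digits shown being correct, i.e. $1.030199563382\le c_0<1.030199563383$), where $\Psi(x)=2^x(1-F(x))$ for $x\ge 0$; the function $\Psi$ is $1$-periodic, that is, $\Psi(x+1)=\Psi(x)$ for all $x\ge 0$, and integrable on $[0,1]$. -/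

import Mathlib

open MeasureTheory Filter Asymptotics

noncomputable section

namespace Minkowski

/-- The `k`-th element `a_k` of the regular continued fraction `x = [a_0, a_1, a_2, ...]`
(Mathlib's expansion by repeated integer and fractional parts); it is set to `0` when the
expansion of `x` stops before `a_k`. -/
def cfElement (x : ℝ) (k : ℕ) : ℤ :=
  (GenContFract.IntFractPair.stream x k).elim 0 (fun p => p.b)

open Classical in
/-- The term `(-1)^k * 2^(-(a_0 + a_1 + ... + a_k))`, or `0` when the expansion of `x` stops
before `a_k`. -/
def cfTerm (x : ℝ) (k : ℕ) : ℝ :=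
  if GenContFract.IntFractPair.stream x k = none then 0
  else (-1) ^ k * (2 : ℝ) ^ (-(∑ i ∈ Finset.range (k + 1), cfElement x i))

/-- `F([a_0, a_1, a_2, ...]) = 1 - 2^(-a_0) + 2^(-(a_0 + a_1)) - 2^(-(a_0 + a_1 + a_2)) + ...` for
`x ≥ 0`, extended by `0` to negative `x`, as a distribution function of a law on `[0, ∞)`. -/
def F (x : ℝ) : ℝ := if 0 ≤ x then 1 - ∑' k, cfTerm x k else 0

/-- Minkowski's question mark function:
`?([0, a_1, a_2, ...]) = 2 * (1 - 2^(-0) + 2^(-(0 + a_1)) - ...) = 2 * F x` for `0 ≤ x ≤ 1`,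
extended by the constants `0` to the left of `0` and `1` (the value at `1`) to the right of `1`. -/
def questionMark (x : ℝ) : ℝ := 2 * F (min x 1)

/-! The rest of this section shows that these functions are monotone, so that they have
Lebesgue-Stieltjes measures. -/

lemma cfElement_zero (x : ℝ) : cfElement x 0 = ⌊x⌋ := rfl

lemma cfElement_succ {x : ℝ} (h : Int.fract x ≠ 0) (k : ℕ) :
    cfElement x (k + 1) = cfElement (Int.fract x)⁻¹ k := by
  simp only [cfElement, GenContFract.IntFractPair.stream_succ h]

lemma cfTerm_zero (x : ℝ) : cfTerm x 0 = (2 : ℝ) ^ (-⌊x⌋) := by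
  simp [cfTerm, cfElement_zero, GenContFract.IntFractPair.stream_zero]

lemma cfTerm_succ {x : ℝ} (h : Int.fract x ≠ 0) (k : ℕ) :
    cfTerm x (k + 1) = -(2 : ℝ) ^ (-⌊x⌋) * cfTerm (Int.fract x)⁻¹ k := by
  unfold cfTerm
  rw [GenContFract.IntFractPair.stream_succ h]
  split_ifs
  · simp
  · rw [Finset.sum_range_succ', cfElement_zero]
    simp only [cfElement_succ h]
    rw [neg_add, zpow_add₀ two_ne_zero, pow_succ]
    ring

lemma cfTerm_succ_of_fract_eq_zero {x : ℝ} (h : Int.fract x = 0) (k : ℕ) :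
    cfTerm x (k + 1) = 0 := by
  have hx : x = (⌊x⌋ : ℤ) := by
    have := Int.floor_add_fract x
    rw [h, add_zero] at this
    exact this.symm
  rw [hx, cfTerm, if_pos (GenContFract.IntFractPair.stream_succ_of_int _ k)]

lemma one_lt_inv_fract {x : ℝ} (h : Int.fract x ≠ 0) : 1 < (Int.fract x)⁻¹ :=
  (one_lt_inv₀ (lt_of_le_of_ne (Int.fract_nonneg x) h.symm)).2 (Int.fract_lt_one x)

lemma two_zpow_neg_floor_le {x : ℝ} (n : ℕ) (h : n ≤ x) :
    (2 : ℝ) ^ (-⌊x⌋) ≤ (1 / 2) ^ n := by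
  have h1 : (n : ℤ) ≤ ⌊x⌋ := Int.le_floor.2 (by exact_mod_cast h)
  calc (2 : ℝ) ^ (-⌊x⌋) ≤ 2 ^ (-(n : ℤ)) := zpow_le_zpow_right₀ one_le_two (neg_le_neg h1)
    _ = (1 / 2) ^ n := by simp

lemma abs_cfTerm_le_of_one_le (k : ℕ) : ∀ {x : ℝ}, 1 ≤ x → |cfTerm x k| ≤ (1 / 2) ^ (k + 1) := by
  induction k with
  | zero =>
    intro x hx
    rw [cfTerm_zero, abs_of_pos (by positivity)]
    simpa using two_zpow_neg_floor_le (x := x) 1 (by simpa using hx)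
  | succ k ih =>
    intro x hx
    by_cases h : Int.fract x = 0
    · rw [cfTerm_succ_of_fract_eq_zero h]; simp
    · rw [cfTerm_succ h, abs_mul, abs_neg, abs_of_pos (show (0 : ℝ) < 2 ^ (-⌊x⌋) by positivity)]
      have h1 := two_zpow_neg_floor_le (x := x) 1 (by simpa using hx)
      have h2 := ih (one_lt_inv_fract h).le
      calc (2 : ℝ) ^ (-⌊x⌋) * |cfTerm (Int.fract x)⁻¹ k| ≤ (1 / 2) ^ 1 * (1 / 2) ^ (k + 1) := by
            gcongr
        _ = (1 / 2) ^ (k + 1 + 1) := by ring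

lemma abs_cfTerm_le {x : ℝ} (hx : 0 ≤ x) (k : ℕ) : |cfTerm x k| ≤ (1 / 2) ^ k := by
  have h1 := two_zpow_neg_floor_le (x := x) 0 (by simpa using hx)
  cases k with
  | zero => rw [cfTerm_zero, abs_of_pos (by positivity)]; exact h1
  | succ k =>
    by_cases h : Int.fract x = 0
    · rw [cfTerm_succ_of_fract_eq_zero h]; simp
    · rw [cfTerm_succ h, abs_mul, abs_neg, abs_of_pos (show (0 : ℝ) < 2 ^ (-⌊x⌋) by positivity)]
      have h2 := abs_cfTerm_le_of_one_le k (one_lt_inv_fract h).le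
      calc (2 : ℝ) ^ (-⌊x⌋) * |cfTerm (Int.fract x)⁻¹ k| ≤ (1 / 2) ^ 0 * (1 / 2) ^ (k + 1) := by
            gcongr
        _ = (1 / 2) ^ (k + 1) := by ring

lemma summable_cfTerm {x : ℝ} (hx : 0 ≤ x) : Summable (cfTerm x) :=
  Summable.of_norm_bounded summable_geometric_two (fun k => abs_cfTerm_le hx k)

lemma tsum_cfTerm {x : ℝ} (hx : 0 ≤ x) (h : Int.fract x ≠ 0) :
    ∑' k, cfTerm x k = (2 : ℝ) ^ (-⌊x⌋) * (1 - ∑' k, cfTerm (Int.fract x)⁻¹ k) := by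
  rw [(summable_cfTerm hx).tsum_eq_zero_add, cfTerm_zero]
  simp only [cfTerm_succ h]
  rw [tsum_mul_left]
  ring

lemma tsum_cfTerm_of_fract_eq_zero {x : ℝ} (hx : 0 ≤ x) (h : Int.fract x = 0) :
    ∑' k, cfTerm x k = (2 : ℝ) ^ (-⌊x⌋) := by
  rw [(summable_cfTerm hx).tsum_eq_zero_add, cfTerm_zero]
  simp [cfTerm_succ_of_fract_eq_zero h]

lemma tsum_cfTerm_mem_step {m M : ℝ} (hm : m ≤ 0) (hM1 : -m ≤ 1 - M)
    (H : ∀ x : ℝ, 1 ≤ x → m ≤ ∑' k, cfTerm x k ∧ ∑' k, cfTerm x k ≤ M) :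
    ∀ x : ℝ, 1 ≤ x → 0 ≤ ∑' k, cfTerm x k ∧ ∑' k, cfTerm x k ≤ (1 - m) / 2 := by
  intro x hx
  have h1 := two_zpow_neg_floor_le (x := x) 1 (by simpa using hx)
  have h0 : (0 : ℝ) < 2 ^ (-⌊x⌋) := by positivity
  by_cases h : Int.fract x = 0
  · rw [tsum_cfTerm_of_fract_eq_zero (by linarith) h]
    constructor <;> linarith
  · rw [tsum_cfTerm (by linarith) h]
    obtain ⟨h2, h3⟩ := H _ (one_lt_inv_fract h).le
    constructor
    · apply mul_nonneg h0.le; linarith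
    · nlinarith

lemma tsum_cfTerm_mem_of_one_le {x : ℝ} (hx : 1 ≤ x) :
    0 ≤ ∑' k, cfTerm x k ∧ ∑' k, cfTerm x k ≤ 1 / 2 := by
  have A : ∀ x : ℝ, 1 ≤ x → |∑' k, cfTerm x k| ≤ 1 := by
    intro x hx
    have hg : HasSum (fun k : ℕ => (1 / 2 : ℝ) ^ (k + 1)) 1 := by
      have := hasSum_geometric_two.mul_left (1 / 2 : ℝ)
      norm_num at this
      simpa [pow_succ, mul_comm] using this
    have := tsum_of_norm_bounded (f := cfTerm x) hg (fun k => abs_cfTerm_le_of_one_le k hx)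
    exact this
  have B : ∀ x : ℝ, 1 ≤ x → 0 ≤ ∑' k, cfTerm x k ∧ ∑' k, cfTerm x k ≤ 1 := by
    intro x hx
    have h1 := two_zpow_neg_floor_le (x := x) 1 (by simpa using hx)
    have h0 : (0 : ℝ) < 2 ^ (-⌊x⌋) := by positivity
    by_cases h : Int.fract x = 0
    · rw [tsum_cfTerm_of_fract_eq_zero (by linarith) h]
      constructor <;> linarith
    · rw [tsum_cfTerm (by linarith) h]
      obtain ⟨h2, h3⟩ := abs_le.1 (A _ (one_lt_inv_fract h).le)
      constructor
      · apply mul_nonneg h0.le; linarith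
      · nlinarith
  have := tsum_cfTerm_mem_step le_rfl (by norm_num) B x hx
  simpa using this

lemma tsum_cfTerm_nonneg {x : ℝ} (hx : 0 ≤ x) : 0 ≤ ∑' k, cfTerm x k := by
  by_cases h : Int.fract x = 0
  · rw [tsum_cfTerm_of_fract_eq_zero hx h]; positivity
  · rw [tsum_cfTerm hx h]
    have := (tsum_cfTerm_mem_of_one_le (one_lt_inv_fract h).le).2
    apply mul_nonneg (by positivity)
    linarith

lemma tsum_cfTerm_le {x : ℝ} (hx : 0 ≤ x) : ∑' k, cfTerm x k ≤ (2 : ℝ) ^ (-⌊x⌋) := by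
  by_cases h : Int.fract x = 0
  · rw [tsum_cfTerm_of_fract_eq_zero hx h]
  · rw [tsum_cfTerm hx h]
    have := (tsum_cfTerm_mem_of_one_le (one_lt_inv_fract h).le).1
    exact mul_le_of_le_one_right (by positivity) (by linarith)

lemma le_tsum_cfTerm {x : ℝ} (hx : 0 ≤ x) : (2 : ℝ) ^ (-⌊x⌋ - 1) ≤ ∑' k, cfTerm x k := by
  have h0 : (0 : ℝ) < 2 ^ (-⌊x⌋) := by positivity
  rw [zpow_sub_one₀ two_ne_zero]
  by_cases h : Int.fract x = 0
  · rw [tsum_cfTerm_of_fract_eq_zero hx h]; linarith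
  · rw [tsum_cfTerm hx h]
    have := (tsum_cfTerm_mem_of_one_le (one_lt_inv_fract h).le).2
    gcongr
    linarith

lemma tsum_cfTerm_sub_step {ε : ℝ} (hε : 0 ≤ ε)
    (H : ∀ u v : ℝ, 1 ≤ u → u < v → ∑' k, cfTerm v k - ∑' k, cfTerm u k ≤ ε)
    {x y : ℝ} (hx : 0 ≤ x) (hxy : x < y) :
    ∑' k, cfTerm y k - ∑' k, cfTerm x k ≤ 2 ^ (-⌊x⌋) * ε := by
  have hp : (0 : ℝ) < 2 ^ (-⌊x⌋) := by positivity
  rcases (Int.floor_mono hxy.le).lt_or_eq with hlt | heq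
  · have h1 := tsum_cfTerm_le (hx.trans hxy.le)
    have h2 := le_tsum_cfTerm hx
    have h3 : (2 : ℝ) ^ (-⌊y⌋) ≤ 2 ^ (-⌊x⌋ - 1) := zpow_le_zpow_right₀ one_le_two (by omega)
    have : 0 ≤ 2 ^ (-⌊x⌋) * ε := by positivity
    linarith
  · have hf : Int.fract x < Int.fract y := by
      rw [Int.fract, Int.fract, heq]; linarith
    have hy0 : Int.fract y ≠ 0 := ((Int.fract_nonneg x).trans_lt hf).ne'
    by_cases h : Int.fract x = 0
    · rw [tsum_cfTerm_of_fract_eq_zero hx h]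
      have h1 := tsum_cfTerm_le (hx.trans hxy.le)
      rw [← heq] at h1
      have : 0 ≤ 2 ^ (-⌊x⌋) * ε := by positivity
      linarith
    · have hlt : (Int.fract y)⁻¹ < (Int.fract x)⁻¹ :=
        inv_strictAnti₀ (lt_of_le_of_ne (Int.fract_nonneg x) (Ne.symm h)) hf
      have := H _ _ (one_lt_inv_fract hy0).le hlt
      rw [tsum_cfTerm hx h, tsum_cfTerm (hx.trans hxy.le) hy0, ← heq, ← mul_sub]
      gcongr
      linarith

lemma tsum_cfTerm_sub_le (n : ℕ) : ∀ u v : ℝ, 1 ≤ u → u < v →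
    ∑' k, cfTerm v k - ∑' k, cfTerm u k ≤ (1 / 2) ^ n := by
  induction n with
  | zero =>
    intro u v hu huv
    have h1 := (tsum_cfTerm_mem_of_one_le (hu.trans huv.le)).2
    have h2 := (tsum_cfTerm_mem_of_one_le hu).1
    simp only [pow_zero]
    linarith
  | succ n ih =>
    intro u v hu huv
    refine (tsum_cfTerm_sub_step (by positivity) ih (zero_le_one.trans hu) huv).trans ?_
    have h1 := two_zpow_neg_floor_le (x := u) 1 (by simpa using hu)
    rw [pow_succ, mul_comm _ (1 / 2 : ℝ)]
    gcongr
    simpa using h1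

lemma tsum_cfTerm_anti {x y : ℝ} (hx : 0 ≤ x) (hxy : x < y) :
    ∑' k, cfTerm y k ≤ ∑' k, cfTerm x k := by
  have H : ∀ u v : ℝ, 1 ≤ u → u < v → ∑' k, cfTerm v k - ∑' k, cfTerm u k ≤ 0 := by
    intro u v hu huv
    exact ge_of_tendsto' (tendsto_pow_atTop_nhds_zero_of_lt_one (by norm_num) (by norm_num))
      (fun n => tsum_cfTerm_sub_le n u v hu huv)
  have := tsum_cfTerm_sub_step le_rfl H hx hxy
  linarith

lemma F_nonneg (x : ℝ) : 0 ≤ F x := by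
  unfold F
  split_ifs with h
  · have h1 := tsum_cfTerm_le h
    have h2 := two_zpow_neg_floor_le (x := x) 0 (by simpa using h)
    simp only [pow_zero] at h2
    linarith
  · exact le_rfl

lemma monotone_F : Monotone F := by
  intro x y hxy
  rcases hxy.eq_or_lt with rfl | hlt
  · exact le_rfl
  by_cases hx : 0 ≤ x
  · have := tsum_cfTerm_anti hx hlt
    simp only [F, if_pos hx, if_pos (hx.trans hxy)]
    linarith
  · rw [F, if_neg hx]
    exact F_nonneg y

lemma monotone_questionMark : Monotone questionMark := by
  intro x y hxy
  exact mul_le_mul_of_nonneg_left (monotone_F (min_le_min_right 1 hxy)) zero_le_two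

/-- The Lebesgue-Stieltjes measure `dF(x)`. -/
def measureF : Measure ℝ := monotone_F.stieltjesFunction.measure

/-- The Lebesgue-Stieltjes measure `d?(x)`. -/
def measureQuestionMark : Measure ℝ := monotone_questionMark.stieltjesFunction.measure

/-- The moment `m_L = ∫_0^1 x^L d?(x)`. -/
def moment (L : ℕ) : ℝ := ∫ x in Set.Icc (0 : ℝ) 1, x ^ L ∂measureQuestionMark

/-- `Ψ(x) = 2^x (1 - F(x))`, considered for `x ≥ 0`. -/
def Psi (x : ℝ) : ℝ := (2 : ℝ) ^ x * (1 - F x)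

/-- `c_0 = ∫_0^1 Ψ(x) dx`. -/
def c0 : ℝ := ∫ x in (0 : ℝ)..1, Psi x

/-- `C = exp(-2 √(log 2))`. -/
def C : ℝ := Real.exp (-2 * √(Real.log 2))

end Minkowski

end

noncomputable section

namespace Minkowski

open Set Topology

/-! Everything rests on the self-similarity of `F`: `F (x + 1) = (1 + F x) / 2` and `F x⁻¹ = 1 - F
x`. In terms of laws, `2 dF` is the sum of `d?` and of the translate of `dF` by one, `dF` is
invariant under inversion, and `d?` is the image of `dF` under `x / (x + 1)`.

Asymptotics. Iterating the first relation gives `m_L = ∑ k, 2^(-k-1) ∫ ((x + k) / (x + k + 1))^L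
d?(x)`. With `f y = (y / (y + 1))^L 2^(-y)` (`powExp`) this is `∫ (2^x / 2) ∑ k, f (x + k) d?(x)`.
The function `f` is a broad smooth bump, so the inner sum is close to `J = ∫_0^∞ f` whatever `x` is,
and the remaining factor `∫ 2^x / 2 d?` equals `c0 log 2` by Fubini (`log_two_mul_c0`). Hence `m_L ≈
c0 log 2 * J` (`abs_moment_sub_le`).

The sum is compared with the integral by the trapezoid rule, whose error is governed by `∫ |f''|`.
Since `f'' = (f')^2 / f - g` with `g = -f (log f)''`, one has `|f''| ≤ f'' + 2 g`. The integral of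
`f''` telescopes, and `∫ g` is smaller than `J` by a factor of order `L^(-1/2)`.

For `J`, the estimate `log (1 + 1/x) = 1 / (x + 1/2) + O((x + 1/2)^(-3))` and a shift by `1/2` lead
to the Bessel integral `√2 ∫ exp (-L / y - y log 2) dy`. The substitution `y = √(L / log 2) exp (2
arsinh w)` makes its exponent exactly Gaussian, which yields the main term with an explicit error
(`abs_moment_sub_main_le`).

Digits of `c0`. By the symmetry of `d?` about `1/2`, `∫ 2^x d?` is a series in the even central
moments. Expanding both sides of `∫ x^(m+1) d? = ∑ n, 2^(-n-1) ∫ (x + n + 1)^(-m-1) d?` about `1/2`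
gives linear relations between these moments. A fixed combination of twelve relations, subtracted
from the series, leaves essentially a multiple of the zeroth moment, which is `1`. The other
coefficients are tiny and are controlled by `|centralMoment (2 h)| ≤ 4^(-h)`, so the linear system
need not be solved. -/

/-! ### Functional equations and continuity of `F` -/

lemma F_of_nonneg {x : ℝ} (hx : 0 ≤ x) : F x = 1 - ∑' k, cfTerm x k := if_pos hx

lemma F_of_neg {x : ℝ} (hx : x < 0) : F x = 0 := if_neg hx.not_ge

lemma F_zero : F 0 = 0 := by
  rw [F_of_nonneg le_rfl, tsum_cfTerm_of_fract_eq_zero le_rfl (by simp)]; simp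

lemma F_of_nonpos {x : ℝ} (hx : x ≤ 0) : F x = 0 := by
  rcases hx.lt_or_eq with h | rfl
  exacts [F_of_neg h, F_zero]

lemma F_lt_one (x : ℝ) : F x < 1 := by
  rcases lt_or_ge x 0 with h | h
  · rw [F_of_neg h]; exact one_pos
  · rw [F_of_nonneg h]
    have h1 := le_tsum_cfTerm h
    have h2 : (0 : ℝ) < 2 ^ (-⌊x⌋ - 1) := by positivity
    linarith

/-- The shift only raises `a_0` by one, which halves the whole alternating series. -/
lemma F_add_one {x : ℝ} (hx : 0 ≤ x) : F (x + 1) = (1 + F x) / 2 := by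
  have hz : (2 : ℝ) ^ (-(⌊x⌋ + 1)) = 2 ^ (-⌊x⌋) / 2 := by
    rw [neg_add, ← sub_eq_add_neg, zpow_sub_one₀ two_ne_zero, div_eq_mul_inv]
  have hx' : 0 ≤ x + 1 := by linarith
  rw [F_of_nonneg hx, F_of_nonneg hx']
  by_cases h : Int.fract x = 0
  · have h' : Int.fract (x + 1) = 0 := by rwa [Int.fract_add_one]
    rw [tsum_cfTerm_of_fract_eq_zero hx h, tsum_cfTerm_of_fract_eq_zero hx' h', Int.floor_add_one,
      hz]
    ring
  · have h' : Int.fract (x + 1) ≠ 0 := by rwa [Int.fract_add_one]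
    rw [tsum_cfTerm hx h, tsum_cfTerm hx' h', Int.fract_add_one, Int.floor_add_one, hz]
    ring

lemma F_one : F 1 = 1 / 2 := by
  have := F_add_one le_rfl
  rwa [zero_add, F_zero, add_zero] at this

lemma F_inv_of_lt_one {x : ℝ} (hx : 0 < x) (hx1 : x < 1) : F x = 1 - F x⁻¹ := by
  have hf : Int.fract x = x := Int.fract_eq_self.2 ⟨hx.le, hx1⟩
  have hfl : ⌊x⌋ = 0 := Int.floor_eq_zero_iff.2 ⟨hx.le, hx1⟩
  have h : Int.fract x ≠ 0 := by rw [hf]; exact hx.ne'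
  rw [F_of_nonneg hx.le, F_of_nonneg (inv_pos.2 hx).le, tsum_cfTerm hx.le h, hf, hfl]
  simp

lemma F_inv {x : ℝ} (hx : 0 < x) : F x⁻¹ = 1 - F x := by
  rcases lt_trichotomy x 1 with h | rfl | h
  · rw [F_inv_of_lt_one hx h]; ring
  · rw [inv_one, F_one]; norm_num
  · rw [F_inv_of_lt_one (inv_pos.2 hx) (inv_lt_one_of_one_lt₀ h), inv_inv]

lemma F_div_add_one {x : ℝ} (hx : 0 ≤ x) : F (x / (x + 1)) = F x / 2 := by
  rcases hx.eq_or_lt with rfl | h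
  · simp [F_zero]
  · have h1 : x / (x + 1) = (x⁻¹ + 1)⁻¹ := by field_simp; ring
    rw [h1, F_inv (by positivity), F_add_one (by positivity), F_inv h]
    ring

/-- Induction on `n`: `x / (x + 1)` halves a value of `F` and `x + 1` maps it to the upper half, so
level `n` produces both halves of level `n + 1`. -/
lemma exists_F_eq_div_two_pow (n : ℕ) : ∀ k : ℕ, k < 2 ^ n → ∃ x : ℝ, F x = k / 2 ^ n := by
  have key : ∀ k : ℕ, k < 2 ^ n → ∃ x : ℝ, 0 ≤ x ∧ F x = k / 2 ^ n := by
    induction n with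
    | zero =>
      intro k hk
      obtain rfl : k = 0 := by simpa using hk
      exact ⟨0, le_rfl, by simp [F_zero]⟩
    | succ n ih =>
      intro k hk
      rcases lt_or_ge k (2 ^ n) with h | h
      · obtain ⟨x, hx, hFx⟩ := ih k h
        refine ⟨x / (x + 1), by positivity, ?_⟩
        rw [F_div_add_one hx, hFx, pow_succ]
        field_simp
      · obtain ⟨x, hx, hFx⟩ := ih (k - 2 ^ n) (by rw [pow_succ] at hk; omega)
        refine ⟨x + 1, by positivity, ?_⟩
        rw [F_add_one hx, hFx, pow_succ, Nat.cast_sub h]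
        push_cast
        field_simp
        ring
  intro k hk
  obtain ⟨x, -, h⟩ := key k hk
  exact ⟨x, h⟩

lemma exists_F_mem_Ioo {a b : ℝ} (ha : 0 ≤ a) (hab : a < b) (hb : b ≤ 1) :
    ∃ x : ℝ, F x ∈ Ioo a b := by
  obtain ⟨n, hn⟩ := exists_pow_lt_of_lt_one (sub_pos.2 hab) (show (1 / 2 : ℝ) < 1 by norm_num)
  have h2 : (0 : ℝ) < 2 ^ n := by positivity
  have hn' : 1 < (b - a) * 2 ^ n := by
    rw [div_pow, one_pow, div_lt_iff₀ h2] at hn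
    exact hn
  have hk1 := Nat.lt_floor_add_one (a * 2 ^ n)
  have hk2 := Nat.floor_le (show 0 ≤ a * 2 ^ n by positivity)
  set k := ⌊a * 2 ^ n⌋₊
  have hkb : ((k + 1 : ℕ) : ℝ) < b * 2 ^ n := by push_cast; linarith
  have hk : k + 1 < 2 ^ n := by
    have : ((k + 1 : ℕ) : ℝ) < 2 ^ n := hkb.trans_le (mul_le_of_le_one_left h2.le hb)
    exact_mod_cast this
  obtain ⟨x, hx⟩ := exists_F_eq_div_two_pow n (k + 1) hk
  refine ⟨x, ?_, ?_⟩
  · rw [hx, lt_div_iff₀ h2]; push_cast; exact hk1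
  · rw [hx, div_lt_iff₀ h2]; exact hkb

/-- A monotone function with values dense in `[0, 1]` has no jumps. -/
lemma continuous_F : Continuous F := by
  refine continuous_iff_continuousAt.2 fun x => ?_
  rw [continuousAt_iff_continuous_left_right]
  constructor
  -- Where `F` vanishes there are no values below to approach from, but there `F` is constant to the
  -- left.
  · rcases (F_nonneg x).eq_or_lt with h | h
    · refine (continuousWithinAt_const (b := (0 : ℝ))).congr (fun y hy => ?_) h.symm
      exact le_antisymm ((monotone_F hy).trans_eq h.symm) (F_nonneg y)
    · refine continuousWithinAt_left_of_monotoneOn_of_exists_between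
        (monotone_F.monotoneOn univ) univ_mem fun b hb => ?_
      obtain ⟨c, hc⟩ := exists_F_mem_Ioo (le_max_right b 0) (max_lt hb h) (F_lt_one x).le
      exact ⟨c, mem_univ _, (le_max_left _ _).trans_lt hc.1, hc.2⟩
  · refine continuousWithinAt_right_of_monotoneOn_of_exists_between
      (monotone_F.monotoneOn univ) univ_mem fun b hb => ?_
    obtain ⟨c, hc⟩ := exists_F_mem_Ioo (F_nonneg x) (lt_min hb (F_lt_one x)) (min_le_right _ _)
    exact ⟨c, mem_univ _, hc.1, hc.2.trans_le (min_le_left _ _)⟩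

lemma tendsto_F_atBot : Tendsto F atBot (𝓝 0) :=
  tendsto_const_nhds.congr' <| by
    filter_upwards [eventually_le_atBot (0 : ℝ)] with x hx
    exact (F_of_nonpos hx).symm

lemma tendsto_F_atTop : Tendsto F atTop (𝓝 1) := by
  refine tendsto_order.2 ⟨fun a ha => ?_, fun a ha => Eventually.of_forall fun x =>
    (F_lt_one x).trans ha⟩
  obtain ⟨c, hc⟩ := exists_F_mem_Ioo (le_max_right a 0) (max_lt ha one_pos) le_rfl
  filter_upwards [eventually_ge_atTop c] with x hx
  exact (le_max_left _ _).trans_lt (hc.1.trans_le (monotone_F hx))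

/-! ### The laws `dF` and `d?` and their self-similarity -/

lemma stieltjesFunction_F (x : ℝ) : monotone_F.stieltjesFunction x = F x := by
  rw [Monotone.stieltjesFunction_eq]
  exact continuous_F.continuousWithinAt.rightLim_eq

lemma continuous_questionMark : Continuous questionMark :=
  (continuous_F.comp (continuous_id.min continuous_const)).const_mul 2

lemma stieltjesFunction_questionMark (x : ℝ) :
    monotone_questionMark.stieltjesFunction x = questionMark x := by
  rw [Monotone.stieltjesFunction_eq]
  exact continuous_questionMark.continuousWithinAt.rightLim_eq

lemma measureF_Iic (x : ℝ) : measureF (Iic x) = ENNReal.ofReal (F x) := by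
  have h : ⇑monotone_F.stieltjesFunction = F := funext stieltjesFunction_F
  rw [measureF, StieltjesFunction.measure_Iic _ (l := 0) (by rw [h]; exact tendsto_F_atBot), h,
    sub_zero]

lemma measureF_Iio (x : ℝ) : measureF (Iio x) = ENNReal.ofReal (F x) := by
  have h : ⇑monotone_F.stieltjesFunction = F := funext stieltjesFunction_F
  rw [measureF, StieltjesFunction.measure_Iio _ (l := 0) (by rw [h]; exact tendsto_F_atBot), h,
    sub_zero, continuous_F.continuousWithinAt.leftLim_eq]

lemma measureQuestionMark_Iic (x : ℝ) :
    measureQuestionMark (Iic x) = ENNReal.ofReal (questionMark x) := by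
  have h : ⇑monotone_questionMark.stieltjesFunction = questionMark :=
    funext stieltjesFunction_questionMark
  rw [measureQuestionMark, StieltjesFunction.measure_Iic _ (l := 0) ?_, h, sub_zero]
  rw [h]
  refine tendsto_const_nhds.congr' ?_
  filter_upwards [eventually_le_atBot (0 : ℝ)] with x hx
  rw [questionMark, F_of_nonpos ((min_le_left _ _).trans hx), mul_zero]

instance isProbabilityMeasure_measureF : IsProbabilityMeasure measureF := by
  have h : ⇑monotone_F.stieltjesFunction = F := funext stieltjesFunction_F
  exact StieltjesFunction.isProbabilityMeasure _ (by rw [h]; exact tendsto_F_atBot)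
    (by rw [h]; exact tendsto_F_atTop)

lemma measureF_Iic_zero : measureF (Iic 0) = 0 := by rw [measureF_Iic, F_zero, ENNReal.ofReal_zero]

lemma ae_measureF_pos : ∀ᵐ x ∂measureF, 0 < x := by
  rw [ae_iff]
  simp only [not_lt]
  exact measureF_Iic_zero

/-- The map `x ↦ x / (x + 1)` pushes the law `dF` on `[0, ∞)` to the law `d?` on `[0, 1]`. -/
def muQ : Measure ℝ := measureF.map fun x => x / (x + 1)

lemma measurable_div_add_one : Measurable fun x : ℝ => x / (x + 1) := by fun_prop

instance isProbabilityMeasure_muQ : IsProbabilityMeasure muQ :=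
  Measure.isProbabilityMeasure_map measurable_div_add_one.aemeasurable

lemma measureF_congr {s t : Set ℝ} (h : ∀ x, 0 < x → (x ∈ s ↔ x ∈ t)) :
    measureF s = measureF t := by
  refine measure_congr ?_
  filter_upwards [ae_measureF_pos] with x hx
  exact propext (h x hx)

lemma muQ_Iic (a : ℝ) : muQ (Iic a) = ENNReal.ofReal (questionMark a) := by
  rw [muQ, Measure.map_apply measurable_div_add_one measurableSet_Iic, questionMark]
  rcases lt_or_ge a 0 with ha | ha
  · rw [min_eq_left (by linarith), F_of_neg ha, mul_zero, ENNReal.ofReal_zero,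
      ← measure_empty (μ := measureF)]
    refine measureF_congr fun x hx => ?_
    simp only [mem_preimage, mem_Iic, mem_empty_iff_false, iff_false, not_le]
    exact ha.trans (by positivity)
  rcases lt_or_ge a 1 with h1 | h1
  · have h1' : 0 < 1 - a := by linarith
    -- `a / (1 - a)` is the preimage of `a` under `x / (x + 1)`.
    have e : a = a / (1 - a) / (a / (1 - a) + 1) := by field_simp; ring
    have : F a = F (a / (1 - a)) / 2 := by
      conv_lhs => rw [e]
      exact F_div_add_one (by positivity)
    rw [min_eq_left h1.le, this, mul_div_cancel₀ _ two_ne_zero, ← measureF_Iic]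
    refine measureF_congr fun x hx => ?_
    simp only [mem_preimage, mem_Iic]
    rw [div_le_iff₀ (by positivity), le_div_iff₀ h1']
    constructor <;> intro h <;> linarith
  · rw [min_eq_right h1, F_one, show (2 : ℝ) * (1 / 2) = 1 by norm_num, ENNReal.ofReal_one,
      ← measure_univ (μ := measureF)]
    refine measureF_congr fun x hx => ?_
    simp only [mem_preimage, mem_Iic, mem_univ, iff_true]
    refine le_trans ?_ h1
    rw [div_le_one (by positivity)]
    linarith

lemma measureQuestionMark_eq : measureQuestionMark = muQ :=
  (Measure.ext_of_Iic _ _ fun a => by rw [muQ_Iic, measureQuestionMark_Iic]).symm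

lemma muQ_eq_restrict : muQ = (2 : ENNReal) • measureF.restrict (Iic 1) := by
  refine Measure.ext_of_Iic _ _ fun a => ?_
  rw [muQ_Iic, Measure.smul_apply, Measure.restrict_apply measurableSet_Iic, Iic_inter_Iic,
    measureF_Iic, questionMark, ENNReal.ofReal_mul zero_le_two]
  simp

/-- This is `F x⁻¹ = 1 - F x` for laws. Inversion turns a closed half-line into the complement of an
open one, and `F` gives the mass of both because it is continuous. -/
lemma map_inv_measureF : measureF.map (fun x => x⁻¹) = measureF := by
  have : IsFiniteMeasure (measureF.map fun x => x⁻¹) := by infer_instance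
  refine Measure.ext_of_Iic _ _ fun a => ?_
  rw [Measure.map_apply measurable_inv measurableSet_Iic]
  rcases le_or_gt a 0 with ha | ha
  · rw [measureF_Iic, F_of_nonpos ha, ENNReal.ofReal_zero, ← measure_empty (μ := measureF)]
    refine measureF_congr fun x hx => ?_
    simp only [mem_preimage, mem_Iic, mem_empty_iff_false, iff_false, not_le]
    exact ha.trans_lt (by positivity)
  · have h1 : measureF ((fun x : ℝ => x⁻¹) ⁻¹' Iic a) = measureF (Iio a⁻¹)ᶜ := by
      refine measureF_congr fun x hx => ?_
      simp only [mem_preimage, mem_Iic, mem_compl_iff, mem_Iio, not_lt]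
      exact inv_le_comm₀ hx ha
    rw [h1, prob_compl_eq_one_sub measurableSet_Iio, measureF_Iio, measureF_Iic, ← ENNReal.ofReal_one,
      ← ENNReal.ofReal_sub _ (F_nonneg _), F_inv ha, sub_sub_cancel]

/-- The law form of `F (x + 1) = (1 + F x) / 2`: half of the mass lies on `[0, 1]`, where it is `d?`
up to the factor, and the other half is a translate of `dF`. -/
lemma two_smul_measureF : (2 : ENNReal) • measureF = measureF.map (fun x => x + 1) + muQ := by
  have hm : Measurable fun x : ℝ => x + 1 := by fun_prop
  have : IsFiniteMeasure ((2 : ENNReal) • measureF) := measureF.smul_finite (by simp)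
  refine Measure.ext_of_Iic _ _ fun a => ?_
  rw [Measure.add_apply, Measure.map_apply hm measurableSet_Iic, muQ_Iic, Measure.smul_apply,
    measureF_Iic, questionMark]
  have h1 : (fun x : ℝ => x + 1) ⁻¹' Iic a = Iic (a - 1) := by
    ext x; simp [le_sub_iff_add_le]
  rw [h1, measureF_Iic, ← ENNReal.ofReal_add (F_nonneg _)
    (mul_nonneg zero_le_two (F_nonneg _)), smul_eq_mul,
    show (2 : ENNReal) = ENNReal.ofReal 2 by simp, ← ENNReal.ofReal_mul zero_le_two]
  congr 1
  rcases le_or_gt a 1 with ha | ha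
  · rw [F_of_nonpos (show a - 1 ≤ 0 by linarith), min_eq_left ha, zero_add]
  · rw [min_eq_right ha.le, F_one]
    have := F_add_one (show 0 ≤ a - 1 by linarith)
    rw [sub_add_cancel] at this
    rw [this]
    ring

lemma ae_muQ : ∀ᵐ x ∂muQ, 0 < x ∧ x < 1 := by
  rw [muQ, ae_map_iff measurable_div_add_one.aemeasurable
    (show MeasurableSet {x : ℝ | 0 < x ∧ x < 1} from measurableSet_Ioo)]
  filter_upwards [ae_measureF_pos] with x hx
  refine ⟨by positivity, ?_⟩
  rw [div_lt_one (by positivity)]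
  linarith

lemma integrable_measureF_of_bound {h : ℝ → ℝ} (hm : Measurable h) {B : ℝ}
    (hB : ∀ x, 0 < x → |h x| ≤ B) : Integrable h measureF := by
  refine Integrable.of_bound hm.aestronglyMeasurable B ?_
  filter_upwards [ae_measureF_pos] with x hx
  exact hB x hx

lemma integrable_muQ_of_bound {h : ℝ → ℝ} (hm : Measurable h) {B : ℝ}
    (hB : ∀ x, 0 < x → x < 1 → |h x| ≤ B) : Integrable h muQ := by
  refine Integrable.of_bound hm.aestronglyMeasurable B ?_
  filter_upwards [ae_muQ] with x hx
  exact hB x hx.1 hx.2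

lemma integrable_muQ_of_continuous {h : ℝ → ℝ} (hc : Continuous h) : Integrable h muQ := by
  obtain ⟨B, hB⟩ := isCompact_Icc.exists_bound_of_continuousOn (s := Icc (0 : ℝ) 1) hc.continuousOn
  exact integrable_muQ_of_bound hc.measurable fun x h0 h1 => hB x ⟨h0.le, h1.le⟩

lemma integral_muQ {h : ℝ → ℝ} (hm : Measurable h) :
    ∫ x, h x ∂muQ = ∫ x, h (x / (x + 1)) ∂measureF :=
  integral_map measurable_div_add_one.aemeasurable hm.aestronglyMeasurable

lemma integral_measureF_inv {h : ℝ → ℝ} (hm : Measurable h) :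
    ∫ x, h x⁻¹ ∂measureF = ∫ x, h x ∂measureF := by
  conv_rhs => rw [← map_inv_measureF]
  exact (integral_map measurable_inv.aemeasurable hm.aestronglyMeasurable).symm

lemma integral_muQ_eq_inv {h : ℝ → ℝ} (hm : Measurable h) :
    ∫ x, h x ∂muQ = ∫ x, h (x + 1)⁻¹ ∂measureF := by
  rw [integral_muQ hm,
    ← integral_measureF_inv (h := fun x => h (x / (x + 1))) (hm.comp measurable_div_add_one)]
  refine integral_congr_ae ?_
  filter_upwards [ae_measureF_pos] with x hx
  have : x⁻¹ / (x⁻¹ + 1) = (x + 1)⁻¹ := by field_simp; ring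
  simp only [this]

/-- By inversion invariance `d?` is the image of `dF` under both `x / (x + 1)` and `1 / (x + 1)`,
and these two add up to `1`. -/
lemma integral_muQ_one_sub {h : ℝ → ℝ} (hm : Measurable h) :
    ∫ x, h (1 - x) ∂muQ = ∫ x, h x ∂muQ := by
  rw [integral_muQ_eq_inv hm, integral_muQ (h := fun x => h (1 - x)) (by fun_prop)]
  refine integral_congr_ae ?_
  filter_upwards [ae_measureF_pos] with x hx
  have : 1 - x / (x + 1) = (x + 1)⁻¹ := by field_simp; ring
  simp only [this]

lemma integrable_and_integral_measureF {h : ℝ → ℝ} (hm : Measurable h)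
    (hi : Integrable h measureF) :
    Integrable (fun x => h (x + 1)) measureF ∧
      ∫ x, h x ∂measureF = (∫ x, h x ∂muQ) / 2 + (∫ x, h (x + 1) ∂measureF) / 2 := by
  have hm1 : Measurable fun x : ℝ => x + 1 := by fun_prop
  have h2 : Integrable h (measureF.map (fun x => x + 1) + muQ) := by
    rw [← two_smul_measureF]
    exact hi.smul_measure (by simp)
  have hl := h2.left_of_add_measure
  have hr := h2.right_of_add_measure
  refine ⟨(integrable_map_measure hm.aestronglyMeasurable hm1.aemeasurable).1 hl, ?_⟩
  have := integral_add_measure hl hr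
  rw [← two_smul_measureF, integral_smul_measure,
    integral_map hm1.aemeasurable hm.aestronglyMeasurable] at this
  simp only [ENNReal.toReal_ofNat, smul_eq_mul] at this
  linarith

/-- `two_smul_measureF` iterated `N` times: each unit interval carries a translate of `d?` with half
the weight of the one before. -/
lemma integral_measureF_eq_sum {h : ℝ → ℝ} (hm : Measurable h) (hi : Integrable h measureF)
    (N : ℕ) : Integrable (fun x => h (x + N)) measureF ∧
      ∫ x, h x ∂measureF = ∑ n ∈ Finset.range N, (1 / 2) ^ (n + 1) * ∫ x, h (x + n) ∂muQ +
        (1 / 2) ^ N * ∫ x, h (x + N) ∂measureF := by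
  induction N with
  | zero => simpa using hi
  | succ N ih =>
    have hm' : Measurable fun x => h (x + N) := by fun_prop
    obtain ⟨h1, h2⟩ := integrable_and_integral_measureF hm' ih.1
    have e : ∀ x : ℝ, x + 1 + N = x + (N + 1 : ℕ) := fun x => by push_cast; ring
    simp only [e] at h1 h2
    refine ⟨h1, ?_⟩
    rw [ih.2, h2, Finset.sum_range_succ]
    ring

/-- The invariance of `d?` under the branches `x ↦ 1 / (x + n + 1)` of the Gauss map, cut off after
`K` branches. It is the source of the relations between moments. -/
lemma integral_muQ_eq_sum {h : ℝ → ℝ} (hm : Measurable h) (hi : Integrable h muQ) (K : ℕ) :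
    ∫ x, h x ∂muQ = ∑ n ∈ Finset.range K, (1 / 2) ^ (n + 1) * ∫ x, h (x + n + 1)⁻¹ ∂muQ +
        (1 / 2) ^ K * ∫ x, h (x + K + 1)⁻¹ ∂measureF := by
  rw [integral_muQ_eq_inv hm]
  refine (integral_measureF_eq_sum (h := fun x => h (x + 1)⁻¹) (by fun_prop) ?_ K).2
  have hi' : Integrable (fun x => h (x / (x + 1))) measureF :=
    (integrable_map_measure hm.aestronglyMeasurable measurable_div_add_one.aemeasurable).1 hi
  rw [← map_inv_measureF] at hi'
  refine ((integrable_map_measure (hm.comp measurable_div_add_one).aestronglyMeasurable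
    measurable_inv.aemeasurable).1 hi').congr ?_
  filter_upwards [ae_measureF_pos] with x hx
  have : x⁻¹ / (x⁻¹ + 1) = (x + 1)⁻¹ := by field_simp; ring
  simp only [Function.comp, this]

lemma moment_eq (L : ℕ) : moment L = ∫ x, x ^ L ∂muQ := by
  rw [moment, measureQuestionMark_eq]
  congr 1
  refine Measure.restrict_eq_self_of_ae_mem ?_
  filter_upwards [ae_muQ] with x hx
  exact ⟨hx.1.le, hx.2.le⟩

lemma moment_eq_integral_measureF (L : ℕ) : moment L = ∫ x, (x / (x + 1)) ^ L ∂measureF := by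
  rw [moment_eq, integral_muQ (by fun_prop)]

lemma setIntegral_Ici_eq_moment (L : ℕ) :
    ∫ x in Ici (0 : ℝ), (x / (x + 1)) ^ L ∂measureF = moment L := by
  rw [moment_eq_integral_measureF]
  congr 1
  refine Measure.restrict_eq_self_of_ae_mem ?_
  filter_upwards [ae_measureF_pos] with x hx
  exact hx.le

lemma two_mul_setIntegral_Icc_eq_moment (L : ℕ) :
    2 * ∫ x in Icc (0 : ℝ) 1, x ^ L ∂measureF = moment L := by
  rw [moment_eq, muQ_eq_restrict, integral_smul_measure]
  simp only [ENNReal.toReal_ofNat, smul_eq_mul]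
  congr 2
  refine Measure.restrict_congr_set ?_
  filter_upwards [ae_measureF_pos] with x hx
  exact propext ⟨fun h => h.2, fun h => ⟨hx.le, h⟩⟩

/-! ### Periodicity of `Psi` and `c0` as an integral against `d?` -/

lemma Psi_add_one {x : ℝ} (hx : 0 ≤ x) : Psi (x + 1) = Psi x := by
  rw [Psi, Psi, F_add_one hx, Real.rpow_add_one two_ne_zero]
  ring

lemma continuous_Psi : Continuous Psi :=
  (Real.continuous_const_rpow two_ne_zero).mul (continuous_const.sub continuous_F)

lemma integral_two_rpow (m : ℝ) :
    ∫ x in (0 : ℝ)..m, (2 : ℝ) ^ x = (2 ^ m - 1) / Real.log 2 := by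
  have hl : Real.log 2 ≠ 0 := (Real.log_pos one_lt_two).ne'
  rw [intervalIntegral.integral_eq_sub_of_hasDerivAt (f := fun x => (2 : ℝ) ^ x / Real.log 2)]
  · rw [Real.rpow_zero]; ring
  · intro x _
    have := (Real.hasStrictDerivAt_const_rpow two_pos x).hasDerivAt.div_const (Real.log 2)
    rwa [mul_div_cancel_right₀ _ hl] at this
  · exact (Real.continuous_const_rpow two_ne_zero).intervalIntegrable _ _

/-- Fubini: `1 - F x` is the mass of `[x, ∞)`, so `c0` is the double integral of `2^x` over `x ≤ y`,
`0 < x ≤ 1`, and the integral over `x` is elementary. -/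
lemma c0_eq_integral_measureF :
    c0 = ∫ y, ((2 : ℝ) ^ (min 1 y) - 1) / Real.log 2 ∂measureF := by
  have hm : Measurable fun z : ℝ × ℝ => {z : ℝ × ℝ | z.1 ≤ z.2}.indicator
      (fun z => (2 : ℝ) ^ z.1) z := by
    refine Measurable.indicator ?_ (measurableSet_le measurable_fst measurable_snd)
    exact (Real.continuous_const_rpow two_ne_zero).measurable.comp measurable_fst
  have hint : Integrable (Function.uncurry fun x y : ℝ => {z : ℝ × ℝ | z.1 ≤ z.2}.indicator
      (fun z => (2 : ℝ) ^ z.1) (x, y)) ((volume.restrict (Ioc (0 : ℝ) 1)).prod measureF) := by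
    refine Integrable.of_bound hm.aestronglyMeasurable 2 ?_
    have : ∀ᵐ z ∂((volume.restrict (Ioc (0 : ℝ) 1)).prod measureF), z.1 ∈ Ioc (0 : ℝ) 1 :=
      Measure.quasiMeasurePreserving_fst.ae (ae_restrict_mem measurableSet_Ioc)
    filter_upwards [this] with z hz
    refine (norm_indicator_le_norm_self (fun z : ℝ × ℝ => (2 : ℝ) ^ z.1) z).trans ?_
    rw [Real.norm_of_nonneg (by positivity)]
    calc (2 : ℝ) ^ z.1 ≤ 2 ^ (1 : ℝ) := Real.rpow_le_rpow_of_exponent_le one_le_two hz.2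
      _ = 2 := Real.rpow_one 2
  rw [c0, intervalIntegral.integral_of_le zero_le_one]
  trans ∫ x in Ioc (0 : ℝ) 1, ∫ y, {z : ℝ × ℝ | z.1 ≤ z.2}.indicator
      (fun z => (2 : ℝ) ^ z.1) (x, y) ∂measureF
  · refine integral_congr_ae (Eventually.of_forall fun x => ?_)
    have h1 : ∀ y : ℝ, {z : ℝ × ℝ | z.1 ≤ z.2}.indicator (fun z => (2 : ℝ) ^ z.1) (x, y) =
        (Ici x).indicator (fun _ => (2 : ℝ) ^ x) y := fun y => by
      simp [indicator]
    simp only [h1]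
    rw [integral_indicator_const _ measurableSet_Ici, Psi, smul_eq_mul, mul_comm]
    congr 1
    rw [← compl_Iio, measureReal_compl measurableSet_Iio, measureReal_def, measureReal_def,
      measureF_Iio, measure_univ, ENNReal.toReal_ofReal (F_nonneg x), ENNReal.toReal_one]
  · rw [integral_integral_swap hint]
    refine integral_congr_ae ?_
    filter_upwards [ae_measureF_pos] with y hy
    have h1 : ∀ x : ℝ, {z : ℝ × ℝ | z.1 ≤ z.2}.indicator (fun z => (2 : ℝ) ^ z.1) (x, y) =
        (Iic y).indicator (fun x => (2 : ℝ) ^ x) x := fun x => by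
      simp [indicator]
    simp only [h1]
    rw [integral_indicator measurableSet_Iic, Measure.restrict_restrict measurableSet_Iic,
      inter_comm, Ioc_inter_Iic, ← intervalIntegral.integral_of_le (by positivity),
      integral_two_rpow]

/-- Splitting `dF` at `1`, the part above `1` contributes the constant `1 / log 2`, which cancels
the `-1` coming from the part below. -/
lemma log_two_mul_c0 : Real.log 2 * c0 = (∫ x, (2 : ℝ) ^ x ∂muQ) / 2 := by
  have hl : Real.log 2 ≠ 0 := (Real.log_pos one_lt_two).ne'
  have hm : Measurable fun y : ℝ => ((2 : ℝ) ^ (min 1 y) - 1) / Real.log 2 := by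
    have := (Real.continuous_const_rpow (a := 2) two_ne_zero).measurable
    fun_prop
  have hb : ∀ y : ℝ, 0 < y → |((2 : ℝ) ^ (min 1 y) - 1) / Real.log 2| ≤ 1 / Real.log 2 := by
    intro y hy
    have h1 : (1 : ℝ) ≤ 2 ^ (min 1 y) := Real.one_le_rpow one_le_two (by positivity)
    have h2 : (2 : ℝ) ^ (min 1 y) ≤ 2 ^ (1 : ℝ) :=
      Real.rpow_le_rpow_of_exponent_le one_le_two (min_le_left _ _)
    rw [Real.rpow_one] at h2
    have hlp := Real.log_pos one_lt_two
    rw [abs_of_nonneg (div_nonneg (by linarith) hlp.le)]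
    gcongr
    linarith
  rw [c0_eq_integral_measureF,
    (integrable_and_integral_measureF hm (integrable_measureF_of_bound hm hb)).2]
  have e1 : ∫ x, ((2 : ℝ) ^ (min 1 (x + 1)) - 1) / Real.log 2 ∂measureF = 1 / Real.log 2 := by
    trans ∫ x, 1 / Real.log 2 ∂measureF
    · refine integral_congr_ae ?_
      filter_upwards [ae_measureF_pos] with x hx
      rw [min_eq_left (by linarith), Real.rpow_one]
      norm_num
    · simp
  have e2 : ∫ x, ((2 : ℝ) ^ (min 1 x) - 1) / Real.log 2 ∂muQ =
      ((∫ x, (2 : ℝ) ^ x ∂muQ) - 1) / Real.log 2 := by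
    trans ∫ x, ((2 : ℝ) ^ x - 1) / Real.log 2 ∂muQ
    · refine integral_congr_ae ?_
      filter_upwards [ae_muQ] with x hx
      rw [min_eq_right hx.2.le]
    · rw [integral_div, integral_sub (integrable_muQ_of_continuous
        (Real.continuous_const_rpow two_ne_zero)) (integrable_const _)]
      simp
  rw [e1, e2]
  field_simp
  ring

/-! ### The Bessel integral by an exact Gaussian substitution -/

/-- The substitution `w ↦ exp (2 arsinh w)` of the line onto `(0, ∞)`. -/
def expArsinh (w : ℝ) : ℝ := Real.exp (2 * Real.arsinh w)

lemma expArsinh_pos (w : ℝ) : 0 < expArsinh w := Real.exp_pos _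

lemma expArsinh_eq (w : ℝ) : expArsinh w = 1 + 2 * w ^ 2 + 2 * w * √(1 + w ^ 2) := by
  have h := Real.sq_sqrt (show 0 ≤ 1 + w ^ 2 by positivity)
  rw [expArsinh, mul_comm, Real.exp_mul, Real.exp_arsinh, Real.rpow_two]
  linear_combination h

lemma expArsinh_neg (w : ℝ) : expArsinh (-w) = (expArsinh w)⁻¹ := by
  rw [expArsinh, Real.arsinh_neg, mul_neg, Real.exp_neg, expArsinh]

lemma one_le_sqrt_one_add_sq (w : ℝ) : 1 ≤ √(1 + w ^ 2) :=
  Real.one_le_sqrt.2 (by nlinarith [sq_nonneg w])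

lemma sqrt_one_add_sq_le (w : ℝ) : √(1 + w ^ 2) ≤ 1 + 2 * w ^ 2 := by
  rw [Real.sqrt_le_left (by positivity)]
  nlinarith [sq_nonneg w, sq_nonneg (w ^ 2)]

lemma expArsinh_le (w : ℝ) : expArsinh w ≤ 2 * (1 + 2 * w ^ 2) := by
  have h := Real.sq_sqrt (show 0 ≤ 1 + w ^ 2 by positivity)
  rw [expArsinh_eq]
  nlinarith [sq_nonneg (w - √(1 + w ^ 2))]

lemma expArsinh_inv_le (w : ℝ) : (expArsinh w)⁻¹ ≤ 2 * (1 + 2 * w ^ 2) := by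
  rw [← expArsinh_neg]
  simpa using expArsinh_le (-w)

lemma continuous_expArsinh : Continuous expArsinh :=
  Real.continuous_exp.comp (Real.continuous_arsinh.const_mul 2)

lemma hasDerivAt_expArsinh (w : ℝ) :
    HasDerivAt expArsinh (2 * expArsinh w / √(1 + w ^ 2)) w := by
  have := ((Real.hasDerivAt_arsinh w).const_mul 2).exp
  refine this.congr_deriv ?_
  rw [expArsinh]
  ring

lemma injective_expArsinh : Function.Injective expArsinh := fun _ _ h =>
  Real.arsinh_injective (mul_left_cancel₀ two_ne_zero (Real.exp_injective h))

lemma image_const_mul_expArsinh {a : ℝ} (ha : 0 < a) :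
    (fun w => a * expArsinh w) '' univ = Ioi 0 := by
  ext y
  simp only [image_univ, mem_range, mem_Ioi]
  constructor
  · rintro ⟨w, rfl⟩
    exact mul_pos ha (expArsinh_pos w)
  · intro hy
    refine ⟨Real.sinh (Real.log (y / a) / 2), ?_⟩
    rw [expArsinh, Real.arsinh_sinh, mul_div_cancel₀ _ two_ne_zero, Real.exp_log (by positivity),
      mul_div_cancel₀ _ ha.ne']

lemma abs_deriv_const_mul_expArsinh {a : ℝ} (ha : 0 < a) (w : ℝ) :
    |a * (2 * expArsinh w / √(1 + w ^ 2))| = a * (2 * expArsinh w / √(1 + w ^ 2)) :=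
  abs_of_pos (by have := expArsinh_pos w; have := one_le_sqrt_one_add_sq w; positivity)

lemma injOn_const_mul_expArsinh {a : ℝ} (ha : 0 < a) :
    InjOn (fun w => a * expArsinh w) univ := fun _ _ _ _ h =>
  injective_expArsinh (mul_left_cancel₀ ha.ne' h)

lemma integral_Ioi_eq_integral_expArsinh {a : ℝ} (ha : 0 < a) (G : ℝ → ℝ) :
    ∫ y in Ioi 0, G y =
      ∫ w, a * (2 * expArsinh w / √(1 + w ^ 2)) * G (a * expArsinh w) := by
  rw [← image_const_mul_expArsinh ha, integral_image_eq_integral_abs_deriv_smul MeasurableSet.univ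
    (fun w _ => ((hasDerivAt_expArsinh w).const_mul a).hasDerivWithinAt)
    (injOn_const_mul_expArsinh ha), Measure.restrict_univ]
  simp only [abs_deriv_const_mul_expArsinh ha, smul_eq_mul]

lemma integrableOn_Ioi_iff_expArsinh {a : ℝ} (ha : 0 < a) (G : ℝ → ℝ) :
    IntegrableOn G (Ioi 0) ↔
      Integrable fun w => a * (2 * expArsinh w / √(1 + w ^ 2)) * G (a * expArsinh w) := by
  rw [← image_const_mul_expArsinh ha, integrableOn_image_iff_integrableOn_abs_deriv_smul
    MeasurableSet.univ (fun w _ => ((hasDerivAt_expArsinh w).const_mul a).hasDerivWithinAt)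
    (injOn_const_mul_expArsinh ha), integrableOn_univ]
  simp only [abs_deriv_const_mul_expArsinh ha, smul_eq_mul]

/-- The integrand `exp (-A / y - l y)` of Bessel type. -/
def expKernel (A l y : ℝ) : ℝ := Real.exp (-(A / y) - l * y)

lemma expKernel_pos (A l y : ℝ) : 0 < expKernel A l y := Real.exp_pos _

/-- With `y = √(A / l) e^(2 s)` the exponent is `-2 √(A l) cosh (2 s)`, and `cosh (2 s) = 1 + 2
sinh² s` with `sinh s = w`. -/
lemma expKernel_expArsinh {A l : ℝ} (hA : 0 < A) (hl : 0 < l) (w : ℝ) :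
    expKernel A l (√(A / l) * expArsinh w) =
      Real.exp (-(2 * √(A * l))) * Real.exp (-(4 * √(A * l)) * w ^ 2) := by
  have hp := expArsinh_pos w
  have e1 : √(A * l) = √A * √l := Real.sqrt_mul hA.le l
  have e2 : √(A / l) = √A / √l := Real.sqrt_div hA.le l
  have hA' := Real.sq_sqrt hA.le
  have hl' := Real.sq_sqrt hl.le
  have hA0 : 0 < √A := Real.sqrt_pos.2 hA
  have hl0 : 0 < √l := Real.sqrt_pos.2 hl
  have h1 : A / (√(A / l) * expArsinh w) = √(A * l) * expArsinh (-w) := by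
    rw [expArsinh_neg, e1, e2]
    field_simp
    linear_combination -hA'
  have h2 : l * (√(A / l) * expArsinh w) = √(A * l) * expArsinh w := by
    rw [e1, e2]
    field_simp
    linear_combination -hl'
  rw [expKernel, h1, h2, ← Real.exp_add, expArsinh_eq, expArsinh_eq]
  congr 1
  rw [neg_sq]
  ring

lemma le_exp_half (x : ℝ) (hx : 0 ≤ x) : x ≤ Real.exp (x / 2) := by
  have := Real.quadratic_le_exp_of_nonneg (show 0 ≤ x / 2 by linarith)
  nlinarith [sq_nonneg (x - 4)]

/-- Half of the Gaussian exponent `4 m w²` absorbs the polynomial growth of the weights; the other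
half remains for integration. -/
lemma sq_one_add_le_exp {m w : ℝ} (hm : 2 ≤ m) :
    (1 + 2 * w ^ 2) ^ 2 ≤ Real.exp (2 * m * w ^ 2) := by
  have h := Real.quadratic_le_exp_of_nonneg (show 0 ≤ 2 * m * w ^ 2 by positivity)
  have h2 : 4 * w ^ 2 ≤ 2 * m * w ^ 2 := by nlinarith [sq_nonneg w]
  nlinarith [mul_self_le_mul_self (show 0 ≤ 4 * w ^ 2 by positivity) h2]

lemma exp_neg_split (m w : ℝ) :
    Real.exp (-(4 * m) * w ^ 2) = (Real.exp (2 * m * w ^ 2))⁻¹ * Real.exp (-(2 * m) * w ^ 2) := by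
  rw [← Real.exp_neg, ← Real.exp_add]
  ring_nf

lemma weight_nonneg (w : ℝ) : 0 ≤ 2 * expArsinh w / √(1 + w ^ 2) :=
  div_nonneg (by linarith [expArsinh_pos w]) (Real.sqrt_nonneg _)

lemma weight_le (w : ℝ) : 2 * expArsinh w / √(1 + w ^ 2) ≤ 2 * expArsinh w :=
  div_le_self (by linarith [expArsinh_pos w]) (one_le_sqrt_one_add_sq w)

lemma measurable_weight : Measurable fun w : ℝ => 2 * expArsinh w / √(1 + w ^ 2) := by
  have := continuous_expArsinh.measurable
  fun_prop

lemma weight_mul_exp_le {m : ℝ} (hm : 2 ≤ m) (w : ℝ) :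
    2 * expArsinh w / √(1 + w ^ 2) * Real.exp (-(4 * m) * w ^ 2) ≤
      4 * Real.exp (-(2 * m) * w ^ 2) := by
  have h1 := (weight_le w).trans (mul_le_mul_of_nonneg_left (expArsinh_le w) zero_le_two)
  have h2 := sq_one_add_le_exp (w := w) hm
  have h3 : 2 * expArsinh w / √(1 + w ^ 2) ≤ 4 * Real.exp (2 * m * w ^ 2) := by
    nlinarith [sq_nonneg w, sq_nonneg (w ^ 2)]
  rw [exp_neg_split]
  calc _ ≤ 4 * Real.exp (2 * m * w ^ 2) *
        ((Real.exp (2 * m * w ^ 2))⁻¹ * Real.exp (-(2 * m) * w ^ 2)) := by gcongr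
    _ = _ := by field_simp

lemma weight_mul_inv_cube_mul_exp_le {m : ℝ} (hm : 2 ≤ m) (w : ℝ) :
    2 * expArsinh w / √(1 + w ^ 2) * (expArsinh w ^ 3)⁻¹ * Real.exp (-(4 * m) * w ^ 2) ≤
      8 * Real.exp (-(2 * m) * w ^ 2) := by
  have hp := expArsinh_pos w
  have h2 := sq_one_add_le_exp (w := w) hm
  have h3 : 2 * expArsinh w / √(1 + w ^ 2) * (expArsinh w ^ 3)⁻¹ ≤
      8 * Real.exp (2 * m * w ^ 2) := by
    calc _ ≤ 2 * expArsinh w * (expArsinh w ^ 3)⁻¹ := by gcongr; exact weight_le w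
      _ = 2 * ((expArsinh w)⁻¹) ^ 2 := by field_simp
      _ ≤ 2 * (2 * (1 + 2 * w ^ 2)) ^ 2 := by gcongr; exact expArsinh_inv_le w
      _ = 8 * (1 + 2 * w ^ 2) ^ 2 := by ring
      _ ≤ _ := by gcongr
  rw [exp_neg_split]
  calc _ ≤ 8 * Real.exp (2 * m * w ^ 2) *
        ((Real.exp (2 * m * w ^ 2))⁻¹ * Real.exp (-(2 * m) * w ^ 2)) := by gcongr
    _ = _ := by field_simp

lemma integrable_weight_mul_exp {m : ℝ} (hm : 2 ≤ m) :
    Integrable fun w : ℝ => 2 * expArsinh w / √(1 + w ^ 2) * Real.exp (-(4 * m) * w ^ 2) := by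
  refine ((integrable_exp_neg_mul_sq (show 0 < 2 * m by linarith)).const_mul 4).mono'
    (measurable_weight.mul (by fun_prop)).aestronglyMeasurable (Eventually.of_forall fun w => ?_)
  rw [Real.norm_of_nonneg (mul_nonneg (weight_nonneg w) (Real.exp_pos _).le)]
  exact weight_mul_exp_le hm w

lemma integrable_weight_mul_inv_cube_mul_exp {m : ℝ} (hm : 2 ≤ m) :
    Integrable fun w : ℝ => 2 * expArsinh w / √(1 + w ^ 2) * (expArsinh w ^ 3)⁻¹ *
      Real.exp (-(4 * m) * w ^ 2) := by
  have hc := continuous_expArsinh.measurable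
  refine ((integrable_exp_neg_mul_sq (show 0 < 2 * m by linarith)).const_mul 8).mono'
    ((measurable_weight.mul (by fun_prop)).mul (by fun_prop)).aestronglyMeasurable
    (Eventually.of_forall fun w => ?_)
  have := expArsinh_pos w
  rw [Real.norm_of_nonneg (mul_nonneg (mul_nonneg (weight_nonneg w) (by positivity))
    (Real.exp_pos _).le)]
  exact weight_mul_inv_cube_mul_exp_le hm w

/-- The weight is `2 (1 + 2 w²) / √(1 + w²) + 4 w`. The odd part integrates to zero, and the even
part is `2` up to `4 w²`, which costs a factor `1 / m` under the Gaussian. -/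
lemma abs_integral_weight_sub_le {m : ℝ} (hm : 2 ≤ m) :
    |(∫ w : ℝ, 2 * expArsinh w / √(1 + w ^ 2) * Real.exp (-(4 * m) * w ^ 2)) -
      2 * √(Real.pi / (4 * m))| ≤ √(Real.pi / (2 * m)) / m := by
  have hm0 : 0 < m := by linarith
  have hi := integrable_weight_mul_exp hm
  have hg := integrable_exp_neg_mul_sq (show 0 < 4 * m by linarith)
  have hg2 := integrable_exp_neg_mul_sq (show 0 < 2 * m by linarith)
  have hodd : ∫ w : ℝ, 4 * w * Real.exp (-(4 * m) * w ^ 2) = 0 := by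
    have := integral_neg_eq_self (fun w : ℝ => 4 * w * Real.exp (-(4 * m) * w ^ 2)) volume
    simp only [neg_sq, mul_neg, neg_mul, integral_neg] at this
    simp only [neg_mul]
    linarith
  have hio : Integrable fun w : ℝ => 4 * w * Real.exp (-(4 * m) * w ^ 2) := by
    have := (integrable_mul_exp_neg_mul_sq (show 0 < 4 * m by linarith)).const_mul 4
    simpa only [mul_assoc] using this
  have e : (∫ w : ℝ, 2 * expArsinh w / √(1 + w ^ 2) * Real.exp (-(4 * m) * w ^ 2)) -
      2 * √(Real.pi / (4 * m)) = ∫ w : ℝ, (2 * expArsinh w / √(1 + w ^ 2) *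
        Real.exp (-(4 * m) * w ^ 2) - 2 * Real.exp (-(4 * m) * w ^ 2) -
          4 * w * Real.exp (-(4 * m) * w ^ 2)) := by
    have hi2 : Integrable fun w : ℝ => 2 * expArsinh w / √(1 + w ^ 2) *
        Real.exp (-(4 * m) * w ^ 2) - 2 * Real.exp (-(4 * m) * w ^ 2) := hi.sub (hg.const_mul 2)
    rw [integral_sub hi2 hio, integral_sub hi (hg.const_mul 2), hodd,
      integral_const_mul, integral_gaussian, sub_zero]
  rw [e]
  have hb : ∀ w : ℝ, |2 * expArsinh w / √(1 + w ^ 2) * Real.exp (-(4 * m) * w ^ 2) -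
      2 * Real.exp (-(4 * m) * w ^ 2) - 4 * w * Real.exp (-(4 * m) * w ^ 2)| ≤
        1 / m * Real.exp (-(2 * m) * w ^ 2) := by
    intro w
    have hs := one_le_sqrt_one_add_sq w
    have hs2 := sqrt_one_add_sq_le w
    have hs0 : 0 < √(1 + w ^ 2) := by linarith
    have h1 : 2 * expArsinh w / √(1 + w ^ 2) * Real.exp (-(4 * m) * w ^ 2) -
        2 * Real.exp (-(4 * m) * w ^ 2) - 4 * w * Real.exp (-(4 * m) * w ^ 2) =
        (2 * (1 + 2 * w ^ 2) / √(1 + w ^ 2) - 2) * Real.exp (-(4 * m) * w ^ 2) := by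
      rw [expArsinh_eq]
      field_simp
      ring
    have h2 : 0 ≤ 2 * (1 + 2 * w ^ 2) / √(1 + w ^ 2) - 2 := by
      rw [sub_nonneg, le_div_iff₀ hs0]
      linarith
    have h3 : 2 * (1 + 2 * w ^ 2) / √(1 + w ^ 2) - 2 ≤ 4 * w ^ 2 := by
      have := div_le_self (show 0 ≤ 2 * (1 + 2 * w ^ 2) by positivity) hs
      linarith
    have h4 : 4 * w ^ 2 ≤ 1 / m * Real.exp (2 * m * w ^ 2) := by
      have := le_exp_half (4 * m * w ^ 2) (by positivity)
      rw [show 4 * m * w ^ 2 / 2 = 2 * m * w ^ 2 by ring] at this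
      rw [one_div, ← div_eq_inv_mul, le_div_iff₀ hm0]
      linarith
    rw [h1, abs_of_nonneg (mul_nonneg h2 (Real.exp_pos _).le), exp_neg_split]
    calc _ ≤ 1 / m * Real.exp (2 * m * w ^ 2) *
        ((Real.exp (2 * m * w ^ 2))⁻¹ * Real.exp (-(2 * m) * w ^ 2)) := by
          gcongr; exact h3.trans h4
      _ = _ := by field_simp
  rw [← Real.norm_eq_abs]
  refine (norm_integral_le_of_norm_le (hg2.const_mul _) (Eventually.of_forall fun w =>
    (Real.norm_eq_abs _).trans_le (hb w))).trans_eq ?_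
  rw [integral_const_mul, integral_gaussian]
  ring

lemma integral_weight_mul_inv_cube_le {m : ℝ} (hm : 2 ≤ m) :
    ∫ w : ℝ, 2 * expArsinh w / √(1 + w ^ 2) * (expArsinh w ^ 3)⁻¹ *
      Real.exp (-(4 * m) * w ^ 2) ≤ 8 * √(Real.pi / (2 * m)) := by
  have hg2 := integrable_exp_neg_mul_sq (show 0 < 2 * m by linarith)
  refine (integral_mono (integrable_weight_mul_inv_cube_mul_exp hm) (hg2.const_mul 8)
    (weight_mul_inv_cube_mul_exp_le hm)).trans_eq ?_
  rw [integral_const_mul, integral_gaussian]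

variable {A l : ℝ}

lemma expKernel_subst (hA : 0 < A) (hl : 0 < l) (w : ℝ) :
    √(A / l) * (2 * expArsinh w / √(1 + w ^ 2)) * expKernel A l (√(A / l) * expArsinh w) =
      √(A / l) * Real.exp (-(2 * √(A * l))) * (2 * expArsinh w / √(1 + w ^ 2) *
        Real.exp (-(4 * √(A * l)) * w ^ 2)) := by
  rw [expKernel_expArsinh hA hl]
  ring

lemma inv_cube_mul_expKernel_subst (hA : 0 < A) (hl : 0 < l) (w : ℝ) :
    √(A / l) * (2 * expArsinh w / √(1 + w ^ 2)) * (((√(A / l) * expArsinh w) ^ 3)⁻¹ *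
      expKernel A l (√(A / l) * expArsinh w)) =
      l / A * Real.exp (-(2 * √(A * l))) * (2 * expArsinh w / √(1 + w ^ 2) *
        (expArsinh w ^ 3)⁻¹ * Real.exp (-(4 * √(A * l)) * w ^ 2)) := by
  have h := Real.sq_sqrt (show 0 ≤ A / l by positivity)
  have h0 : 0 < √(A / l) := Real.sqrt_pos.2 (by positivity)
  have e : l / A = √(A / l) * (√(A / l) ^ 3)⁻¹ := by
    rw [pow_succ, h]
    field_simp
  rw [expKernel_expArsinh hA hl, e, mul_pow, mul_inv]
  ring

lemma integrableOn_expKernel (hA : 0 < A) (hl : 0 < l) (hm : 2 ≤ √(A * l)) :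
    IntegrableOn (expKernel A l) (Ioi 0) := by
  rw [integrableOn_Ioi_iff_expArsinh (a := √(A / l)) (Real.sqrt_pos.2 (by positivity))]
  simp only [expKernel_subst hA hl]
  exact (integrable_weight_mul_exp hm).const_mul _

lemma integrableOn_inv_cube_mul_expKernel (hA : 0 < A) (hl : 0 < l) (hm : 2 ≤ √(A * l)) :
    IntegrableOn (fun y => (y ^ 3)⁻¹ * expKernel A l y) (Ioi 0) := by
  rw [integrableOn_Ioi_iff_expArsinh (a := √(A / l)) (Real.sqrt_pos.2 (by positivity))]
  simp only [inv_cube_mul_expKernel_subst hA hl]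
  exact (integrable_weight_mul_inv_cube_mul_exp hm).const_mul _

lemma abs_integral_expKernel_sub_le (hA : 0 < A) (hl : 0 < l) (hm : 2 ≤ √(A * l)) :
    |(∫ y in Ioi 0, expKernel A l y) -
      √(A / l) * Real.exp (-(2 * √(A * l))) * (2 * √(Real.pi / (4 * √(A * l))))| ≤
      √(A / l) * Real.exp (-(2 * √(A * l))) * (√(Real.pi / (2 * √(A * l))) / √(A * l)) := by
  rw [integral_Ioi_eq_integral_expArsinh (a := √(A / l)) (Real.sqrt_pos.2 (by positivity))]
  simp only [expKernel_subst hA hl]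
  rw [integral_const_mul, ← mul_sub, abs_mul, abs_of_nonneg (by positivity)]
  exact mul_le_mul_of_nonneg_left (abs_integral_weight_sub_le hm) (by positivity)

/-- This controls every secondary error: multiplied by `A`, it is smaller than the integral of
`expKernel` by a factor of order `1 / √A` for fixed `l`. -/
lemma integral_inv_cube_mul_expKernel_le (hA : 0 < A) (hl : 0 < l) (hm : 2 ≤ √(A * l)) :
    ∫ y in Ioi 0, (y ^ 3)⁻¹ * expKernel A l y ≤
      l / A * Real.exp (-(2 * √(A * l))) * (8 * √(Real.pi / (2 * √(A * l)))) := by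
  rw [integral_Ioi_eq_integral_expArsinh (a := √(A / l)) (Real.sqrt_pos.2 (by positivity))]
  simp only [inv_cube_mul_expKernel_subst hA hl]
  rw [integral_const_mul]
  exact mul_le_mul_of_nonneg_left (integral_weight_mul_inv_cube_le hm) (by positivity)

/-! ### Comparison of `∫ powExp` with the Bessel integral -/

lemma div_add_one_pow_eq_exp (L : ℕ) {x : ℝ} (hx : 0 < x) :
    (x / (x + 1)) ^ L = Real.exp (-(L * Real.log (1 + x⁻¹))) := by
  have e : x / (x + 1) = (1 + x⁻¹)⁻¹ := by field_simp
  have h0 : 0 < 1 + x⁻¹ := by positivity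
  rw [Real.exp_neg, mul_comm, Real.exp_mul, Real.exp_log h0, Real.rpow_natCast, e, inv_pow]

lemma inv_add_half_le_log {x : ℝ} (hx : 0 < x) : (x + 1 / 2)⁻¹ ≤ Real.log (1 + x⁻¹) := by
  refine le_trans (le_of_eq ?_) (Real.le_log_one_add_of_nonneg (inv_pos.2 hx).le)
  field_simp
  ring

/-- In `w = 1 / (2 x + 1)` the logarithm is `2 (w + w³ / 3 + ...)`, with odd powers only. Centring
at `x + 1 / 2` therefore leaves an error of third order, small enough after multiplication by `L`.
-/
lemma log_le_inv_add_half {x : ℝ} (hx : 1 / 2 ≤ x) :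
    Real.log (1 + x⁻¹) ≤ (x + 1 / 2)⁻¹ + ((x + 1 / 2) ^ 3)⁻¹ := by
  have hx0 : 0 < x := by linarith
  set w : ℝ := 1 / (2 * x + 1) with hw
  have hw0 : 0 ≤ w := by positivity
  have hw1 : w ≤ 1 / 2 := by
    rw [hw]; exact one_div_le_one_div_of_le two_pos (by linarith)
  have h := Real.hasSum_log_one_add_inv hx0
  have hg := (hasSum_geometric_of_lt_one (r := w ^ 2) (by positivity)
    (by nlinarith)).mul_left (2 * w ^ 3)
  have h1 : Real.log (1 + x⁻¹) - 2 * w ≤ 2 * w ^ 3 * (1 - w ^ 2)⁻¹ := by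
    have h' := (hasSum_nat_add_iff' 1).2 h
    simp only [Finset.sum_range_one, Nat.cast_zero, mul_zero, zero_add, div_one, mul_one,
      pow_one] at h'
    refine hasSum_le (fun k => ?_) h' hg
    rw [← hw]
    have e : w ^ (2 * (k + 1) + 1) = w ^ 3 * (w ^ 2) ^ k := by rw [← pow_mul, ← pow_add]; ring_nf
    rw [e]
    have : 2 * (1 / (2 * ((k + 1 : ℕ) : ℝ) + 1)) ≤ 2 := by
      have h3 : (1 : ℝ) ≤ 2 * ((k + 1 : ℕ) : ℝ) + 1 := by
        have : (0 : ℝ) ≤ ((k + 1 : ℕ) : ℝ) := by positivity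
        linarith
      have := one_div_le_one_div_of_le one_pos h3
      linarith
    calc _ ≤ 2 * (w ^ 3 * (w ^ 2) ^ k) := by gcongr
      _ = _ := by ring
  have h2 : (1 - w ^ 2)⁻¹ ≤ 4 := by
    rw [inv_le_comm₀ (by nlinarith) (by norm_num)]
    nlinarith
  have e1 : (x + 1 / 2)⁻¹ = 2 * w := by rw [hw]; field_simp
  have e2 : ((x + 1 / 2) ^ 3)⁻¹ = 8 * w ^ 3 := by rw [← inv_pow, e1]; ring
  rw [e1, e2]
  have : 2 * w ^ 3 * (1 - w ^ 2)⁻¹ ≤ 2 * w ^ 3 * 4 := by gcongr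
  linarith

lemma div_add_one_pow_le (L : ℕ) {x : ℝ} (hx : 0 < x) :
    (x / (x + 1)) ^ L ≤ Real.exp (-(L / (x + 1 / 2))) := by
  rw [div_add_one_pow_eq_exp L hx, Real.exp_le_exp, neg_le_neg_iff, div_eq_mul_inv]
  gcongr
  exact inv_add_half_le_log hx

lemma le_div_add_one_pow (L : ℕ) {x : ℝ} (hx : 1 / 2 ≤ x) :
    Real.exp (-(L / (x + 1 / 2))) * (1 - L * ((x + 1 / 2) ^ 3)⁻¹) ≤ (x / (x + 1)) ^ L := by
  have h := mul_le_mul_of_nonneg_left (log_le_inv_add_half hx) (Nat.cast_nonneg (α := ℝ) L)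
  have h2 := Real.add_one_le_exp (-(L * ((x + 1 / 2) ^ 3)⁻¹))
  rw [div_add_one_pow_eq_exp L (by linarith)]
  calc _ ≤ Real.exp (-(L / (x + 1 / 2))) * Real.exp (-(L * ((x + 1 / 2) ^ 3)⁻¹)) := by
        gcongr; linarith
    _ = Real.exp (-(L / (x + 1 / 2)) + -(L * ((x + 1 / 2) ^ 3)⁻¹)) := (Real.exp_add _ _).symm
    _ ≤ _ := by
        rw [Real.exp_le_exp, div_eq_mul_inv]
        linarith

/-- The function `(x / (x + 1)) ^ L * exp (-l x)`. -/
def powExp (L : ℕ) (l x : ℝ) : ℝ := (x / (x + 1)) ^ L * Real.exp (-l * x)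

lemma measurable_powExp (L : ℕ) (l : ℝ) : Measurable (powExp L l) := by
  unfold powExp; fun_prop

lemma powExp_nonneg (L : ℕ) (l : ℝ) {x : ℝ} (hx : 0 ≤ x) : 0 ≤ powExp L l x := by
  unfold powExp; positivity

lemma powExp_le_exp (L : ℕ) (l : ℝ) {x : ℝ} (hx : 0 ≤ x) : powExp L l x ≤ Real.exp (-l * x) := by
  unfold powExp
  refine mul_le_of_le_one_left (Real.exp_pos _).le (pow_le_one₀ (by positivity) ?_)
  rw [div_le_one (by positivity)]
  linarith

lemma integrableOn_powExp (L : ℕ) {l : ℝ} (hl : 0 < l) : IntegrableOn (powExp L l) (Ioi 0) := by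
  refine (integrableOn_exp_mul_Ioi (a := -l) (by linarith) 0).mono'
    (measurable_powExp L l).aestronglyMeasurable ?_
  filter_upwards [ae_restrict_mem measurableSet_Ioi] with x hx
  rw [Real.norm_of_nonneg (powExp_nonneg L l (le_of_lt hx))]
  exact powExp_le_exp L l (le_of_lt hx)

lemma expKernel_eq (A l y : ℝ) :
    expKernel A l y = Real.exp (-(A / y)) * Real.exp (-l * y) := by
  rw [expKernel, ← Real.exp_add]
  ring_nf

lemma abs_integral_powExp_sub_le (L : ℕ) {l : ℝ} (hL : 0 < L) (hl : 0 < l)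
    (hm : 2 ≤ √(L * l)) :
    |(∫ x in Ioi 0, powExp L l x) - Real.exp (l / 2) * ∫ y in Ioi 0, expKernel L l y| ≤
      Real.exp (l / 2) * ((1 + L) * ∫ y in Ioi 0, (y ^ 3)⁻¹ * expKernel L l y) := by
  have hL' : (0 : ℝ) < L := by exact_mod_cast hL
  -- The integrand in the variable `y = x + 1 / 2`, without the factor `exp (l / 2)` and extended by
  -- zero, so that both integrals run over `(0, ∞)`.
  set q : ℝ → ℝ := (Ioi (1 / 2)).indicator fun y =>
    ((y - 1 / 2) / (y - 1 / 2 + 1)) ^ L * Real.exp (-l * y) with hq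
  have hqm : Measurable q := Measurable.indicator (by fun_prop) measurableSet_Ioi
  have e1 : ∫ x in Ioi 0, powExp L l x = Real.exp (l / 2) * ∫ y in Ioi 0, q y := by
    rw [← integral_indicator measurableSet_Ioi, ← integral_indicator measurableSet_Ioi,
      ← integral_const_mul, ← integral_sub_right_eq_self _ (1 / 2 : ℝ)]
    congr 1
    ext y
    by_cases hy : 1 / 2 < y
    · have h0 : 0 < y := by linarith
      rw [indicator_of_mem (by simpa using hy), indicator_of_mem (by simpa using h0), hq,
        indicator_of_mem (by simpa using hy), powExp,
        show -l * (y - 1 / 2) = l / 2 + -l * y by ring, Real.exp_add]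
      ring
    · rw [indicator_of_notMem (by simpa using hy)]
      have : q y = 0 := indicator_of_notMem (by simpa using hy) _
      by_cases h0 : 0 < y
      · rw [indicator_of_mem (by simpa using h0), this, mul_zero]
      · rw [indicator_of_notMem (by simpa using h0), mul_zero]
  have hK := integrableOn_expKernel hL' hl hm
  have hK3 := integrableOn_inv_cube_mul_expKernel hL' hl hm
  have hq0 : ∀ y, 0 ≤ q y := fun y => by
    refine indicator_nonneg (fun y hy => ?_) y
    have : 0 < y - 1 / 2 := sub_pos.2 hy
    positivity
  have hqle : ∀ y, 0 < y → q y ≤ expKernel L l y := fun y hy0 => by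
    by_cases hy : 1 / 2 < y
    · rw [hq, indicator_of_mem (by simpa using hy), expKernel_eq]
      have := div_add_one_pow_le L (sub_pos.2 hy)
      rw [sub_add_cancel] at this
      gcongr
    · rw [hq, indicator_of_notMem (by simpa using hy)]
      exact (expKernel_pos _ _ _).le
  have hqi : IntegrableOn q (Ioi 0) := by
    refine hK.mono' hqm.aestronglyMeasurable ?_
    filter_upwards [ae_restrict_mem measurableSet_Ioi] with y hy
    rw [Real.norm_of_nonneg (hq0 y)]
    exact hqle y hy
  have hlow : ∀ y, 0 < y →
      expKernel L l y - q y ≤ (1 + L) * ((y ^ 3)⁻¹ * expKernel L l y) := fun y hy0 => by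
    have hp := expKernel_pos L l y
    -- For `y ≤ 1` the factor `y⁻³ ≥ 1` makes the bound trivial; this is the `1` in `1 + L`.
    rcases le_or_gt y 1 with h1 | h1
    · have h3 : 1 ≤ (y ^ 3)⁻¹ := one_le_inv₀ (by positivity) |>.2 (pow_le_one₀ hy0.le h1)
      have : 1 * expKernel L l y ≤ (y ^ 3)⁻¹ * expKernel L l y := by gcongr
      have h4 : 0 ≤ L * ((y ^ 3)⁻¹ * expKernel L l y) := by positivity
      have := hq0 y
      linarith
    · have hy : 1 / 2 < y := by linarith
      have h2 := le_div_add_one_pow L (show 1 / 2 ≤ y - 1 / 2 by linarith)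
      rw [sub_add_cancel] at h2
      have h3 : expKernel L l y * (1 - L * (y ^ 3)⁻¹) ≤ q y := by
        rw [hq, indicator_of_mem (by simpa using hy), expKernel_eq]
        calc _ = Real.exp (-(L / y)) * (1 - L * (y ^ 3)⁻¹) * Real.exp (-l * y) := by ring
          _ ≤ _ := by gcongr
      have h4 : 0 ≤ (y ^ 3)⁻¹ * expKernel L l y := by positivity
      nlinarith
  rw [e1, ← mul_sub, abs_mul, abs_of_pos (Real.exp_pos _)]
  refine mul_le_mul_of_nonneg_left ?_ (Real.exp_pos _).le
  rw [abs_sub_comm, ← integral_sub hK hqi, ← integral_const_mul, abs_of_nonneg]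
  · exact setIntegral_mono_on (hK.sub hqi) (hK3.const_mul _) measurableSet_Ioi hlow
  · exact setIntegral_nonneg measurableSet_Ioi fun y hy => sub_nonneg.2 (hqle y hy)

/-! ### The trapezoid rule with an error in terms of `f'` and `g` -/

section Trapezoid

variable {f f' f'' g : ℝ → ℝ}

/-- The trapezoid error is the integral of `f''` against the Peano kernel `(x - a) (a + 1 - x) / 2`,
which lies between `0` and `1 / 8`. Bounding `|f''|` by `f'' + 2 g` leaves an integral of `f''` that
telescopes over adjacent intervals. -/
lemma abs_trapezoid_sub_integral_le {a : ℝ}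
    (hf : ∀ x ∈ Icc a (a + 1), HasDerivAt f (f' x) x)
    (hf' : ∀ x ∈ Icc a (a + 1), HasDerivAt f' (f'' x) x)
    (hf'' : ContinuousOn f'' (Icc a (a + 1))) (hg : ContinuousOn g (Icc a (a + 1)))
    (hfg : ∀ x ∈ Icc a (a + 1), |f'' x| ≤ f'' x + 2 * g x) :
    |(f a + f (a + 1)) / 2 - ∫ x in a..a + 1, f x| ≤
      (f' (a + 1) - f' a) / 8 + (∫ x in a..a + 1, g x) / 4 := by
  have hle : a ≤ a + 1 := by linarith
  have hu : uIcc a (a + 1) = Icc a (a + 1) := uIcc_of_le hle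
  have hfc : ContinuousOn f (Icc a (a + 1)) := fun x hx =>
    (hf x hx).continuousAt.continuousWithinAt
  have hfi : IntervalIntegrable f volume a (a + 1) := (hu ▸ hfc).intervalIntegrable
  have hf''i : IntervalIntegrable f'' volume a (a + 1) := (hu ▸ hf'').intervalIntegrable
  have hgi : IntervalIntegrable g volume a (a + 1) := (hu ▸ hg).intervalIntegrable
  have hki : IntervalIntegrable (fun x => (x - a) * (a + 1 - x) / 2 * f'' x) volume a (a + 1) := by
    refine ContinuousOn.intervalIntegrable (hu ▸ ContinuousOn.mul ?_ hf'')
    exact Continuous.continuousOn (by fun_prop)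
  have h1 : ∫ x in a..a + 1, ((x - a) * (a + 1 - x) / 2 * f'' x + f x) =
      (f a + f (a + 1)) / 2 := by
    rw [intervalIntegral.integral_eq_sub_of_hasDerivAt
      (f := fun x => (x - a) * (a + 1 - x) / 2 * f' x - (2 * a + 1 - 2 * x) / 2 * f x) ?_
      (hki.add hfi)]
    · ring
    · intro x hx
      rw [hu] at hx
      have d1 : HasDerivAt (fun x : ℝ => (x - a) * (a + 1 - x) / 2)
          ((1 * (a + 1 - x) + (x - a) * (-1)) / 2) x :=
        (((hasDerivAt_id x).sub_const a).mul ((hasDerivAt_id x).const_sub (a + 1))).div_const 2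
      have d2 : HasDerivAt (fun x : ℝ => (2 * a + 1 - 2 * x) / 2) (-(2 * 1) / 2) x :=
        (((hasDerivAt_id x).const_mul 2).const_sub (2 * a + 1)).div_const 2
      refine ((d1.mul (hf' x hx)).sub (d2.mul (hf x hx))).congr_deriv ?_
      ring
  have h2 : ∫ x in a..a + 1, f'' x = f' (a + 1) - f' a :=
    intervalIntegral.integral_eq_sub_of_hasDerivAt (fun x hx => hf' x (hu ▸ hx)) hf''i
  rw [intervalIntegral.integral_add hki hfi] at h1
  rw [← h1, add_sub_cancel_right]
  refine (intervalIntegral.abs_integral_le_integral_abs hle).trans ?_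
  have h3 : ∫ x in a..a + 1, (f'' x + 2 * g x) / 8 =
      (f' (a + 1) - f' a) / 8 + (∫ x in a..a + 1, g x) / 4 := by
    rw [intervalIntegral.integral_div, intervalIntegral.integral_add hf''i (hgi.const_mul 2),
      intervalIntegral.integral_const_mul, h2]
    ring
  rw [← h3]
  refine intervalIntegral.integral_mono_on hle hki.abs ((hf''i.add (hgi.const_mul 2)).div_const 8)
    fun x hx => ?_
  have h4 := hfg x hx
  have h5 : 0 ≤ (x - a) * (a + 1 - x) := mul_nonneg (by linarith [hx.1]) (by linarith [hx.2])
  have h6 : (x - a) * (a + 1 - x) / 2 ≤ 1 / 8 := by nlinarith [sq_nonneg (2 * x - 2 * a - 1)]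
  rw [abs_mul, abs_of_nonneg (by positivity)]
  calc _ ≤ 1 / 8 * (f'' x + 2 * g x) := by gcongr
    _ = _ := by ring

lemma abs_sum_sub_integral_le
    (hf : ∀ x, 0 ≤ x → HasDerivAt f (f' x) x) (hf' : ∀ x, 0 ≤ x → HasDerivAt f' (f'' x) x)
    (hf'' : ContinuousOn f'' (Ici 0)) (hg : ContinuousOn g (Ici 0))
    (hfg : ∀ x, 0 ≤ x → |f'' x| ≤ f'' x + 2 * g x) {t : ℝ} (ht : 0 ≤ t) (N : ℕ) :
    |∑ n ∈ Finset.range N, f (t + n) - f t / 2 + f (t + N) / 2 - ∫ x in t..t + N, f x| ≤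
      (f' (t + N) - f' t) / 8 + (∫ x in t..t + N, g x) / 4 := by
  have hfc : ContinuousOn f (Ici 0) := fun x hx => (hf x hx).continuousAt.continuousWithinAt
  have hi : ∀ {h : ℝ → ℝ}, ContinuousOn h (Ici 0) → ∀ a b : ℝ, 0 ≤ a → 0 ≤ b →
      IntervalIntegrable h volume a b := fun hh a b ha hb =>
    (hh.mono fun x hx => (le_min ha hb).trans hx.1).intervalIntegrable
  induction N with
  | zero => simp
  | succ N ih =>
    have ha : 0 ≤ t + N := by positivity
    have hs : Icc (t + N) (t + N + 1) ⊆ Ici 0 := fun x hx => ha.trans hx.1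
    have h := abs_trapezoid_sub_integral_le (fun x hx => hf x (hs hx)) (fun x hx => hf' x (hs hx))
      (hf''.mono hs) (hg.mono hs) (fun x hx => hfg x (hs hx))
    have e : t + (N + 1 : ℕ) = t + N + 1 := by push_cast; ring
    rw [e, Finset.sum_range_succ,
      ← intervalIntegral.integral_add_adjacent_intervals (hi hfc t (t + N) ht ha)
        (hi hfc (t + N) (t + N + 1) ha (by positivity)),
      ← intervalIntegral.integral_add_adjacent_intervals (hi hg t (t + N) ht ha)
        (hi hg (t + N) (t + N + 1) ha (by positivity))]
    rw [abs_le] at ih h ⊢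
    constructor <;> linarith [ih.1, ih.2, h.1, h.2]

end Trapezoid

/-! ### From the sum of `powExp` over a shifted lattice to its integral -/

/-- The derivative of `powExp (n + 2) l`. -/
def powExpDeriv (n : ℕ) (l x : ℝ) : ℝ :=
  ((n + 2) * (x + 1)⁻¹ ^ 2 * (1 - (x + 1)⁻¹) ^ (n + 1) - l * (1 - (x + 1)⁻¹) ^ (n + 2)) *
    Real.exp (-l * x)

/-- The second derivative of `powExp (n + 2) l`. -/
def powExpDeriv2 (n : ℕ) (l x : ℝ) : ℝ :=
  ((n + 2) * (n + 1) * (x + 1)⁻¹ ^ 4 * (1 - (x + 1)⁻¹) ^ n -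
    2 * (n + 2) * (x + 1)⁻¹ ^ 3 * (1 - (x + 1)⁻¹) ^ (n + 1) -
    2 * l * (n + 2) * (x + 1)⁻¹ ^ 2 * (1 - (x + 1)⁻¹) ^ (n + 1) +
    l ^ 2 * (1 - (x + 1)⁻¹) ^ (n + 2)) * Real.exp (-l * x)

/-- The second derivative of `-log (powExp (n + 2) l)`, times `powExp (n + 2) l`. -/
def powExpCurv (n : ℕ) (l x : ℝ) : ℝ :=
  (n + 2) * (2 - (x + 1)⁻¹) * (x + 1)⁻¹ ^ 3 * (1 - (x + 1)⁻¹) ^ n * Real.exp (-l * x)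

lemma hasDerivAt_inv_add_one {x : ℝ} (hx : 0 ≤ x) :
    HasDerivAt (fun x : ℝ => (x + 1)⁻¹) (-(x + 1)⁻¹ ^ 2) x := by
  have h : x + 1 ≠ 0 := by positivity
  refine (((hasDerivAt_id x).add_const 1).fun_inv h).congr_deriv ?_
  simp only [id]
  field_simp

lemma hasDerivAt_exp_neg_mul (l x : ℝ) :
    HasDerivAt (fun x : ℝ => Real.exp (-l * x)) (-l * Real.exp (-l * x)) x := by
  refine (((hasDerivAt_id x).const_mul (-l)).exp).congr_deriv ?_
  simp only [id]
  ring

lemma div_add_one_eq {x : ℝ} (hx : x + 1 ≠ 0) : x / (x + 1) = 1 - (x + 1)⁻¹ := by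
  field_simp
  ring

lemma hasDerivAt_one_sub_inv_pow {x : ℝ} (hx : 0 ≤ x) (n : ℕ) :
    HasDerivAt (fun x : ℝ => (1 - (x + 1)⁻¹) ^ (n + 1))
      ((n + 1) * (1 - (x + 1)⁻¹) ^ n * (x + 1)⁻¹ ^ 2) x := by
  refine (((hasDerivAt_inv_add_one hx).const_sub 1).pow (n + 1)).congr_deriv ?_
  push_cast
  simp

lemma hasDerivAt_powExp (n : ℕ) (l : ℝ) {x : ℝ} (hx : 0 ≤ x) :
    HasDerivAt (powExp (n + 2) l) (powExpDeriv n l x) x := by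
  have h := (hasDerivAt_one_sub_inv_pow hx (n + 1)).mul (hasDerivAt_exp_neg_mul l x)
  refine (h.congr_deriv ?_).congr_of_eventuallyEq ?_
  · rw [powExpDeriv]
    push_cast
    ring
  · filter_upwards [eventually_gt_nhds (show (-1 : ℝ) < x by linarith)] with y hy
    rw [powExp, div_add_one_eq (by linarith)]
    rfl

lemma hasDerivAt_powExpDeriv (n : ℕ) (l : ℝ) {x : ℝ} (hx : 0 ≤ x) :
    HasDerivAt (powExpDeriv n l) (powExpDeriv2 n l x) x := by
  have h1 := ((hasDerivAt_inv_add_one hx).pow 2).const_mul ((n : ℝ) + 2)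
  have h2 := (h1.mul (hasDerivAt_one_sub_inv_pow hx n)).sub
    ((hasDerivAt_one_sub_inv_pow hx (n + 1)).const_mul l)
  refine (h2.mul (hasDerivAt_exp_neg_mul l x)).congr_deriv ?_
  rw [powExpDeriv2]
  simp only [Pi.pow_apply, Pi.mul_apply, Pi.sub_apply]
  push_cast
  ring

lemma continuousOn_inv_add_one : ContinuousOn (fun x : ℝ => (x + 1)⁻¹) (Ici 0) :=
  ContinuousOn.inv₀ (by fun_prop) fun x hx => by
    have : (0 : ℝ) ≤ x := hx
    positivity

lemma continuousOn_powExpDeriv2 (n : ℕ) (l : ℝ) : ContinuousOn (powExpDeriv2 n l) (Ici 0) := by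
  have := continuousOn_inv_add_one
  unfold powExpDeriv2
  fun_prop

lemma continuousOn_powExpCurv (n : ℕ) (l : ℝ) : ContinuousOn (powExpCurv n l) (Ici 0) := by
  have := continuousOn_inv_add_one
  unfold powExpCurv
  fun_prop

lemma inv_add_one_mem {x : ℝ} (hx : 0 ≤ x) : 0 < (x + 1)⁻¹ ∧ (x + 1)⁻¹ ≤ 1 :=
  ⟨by positivity, inv_le_one_of_one_le₀ (by linarith)⟩

lemma powExpCurv_nonneg (n : ℕ) (l : ℝ) {x : ℝ} (hx : 0 ≤ x) : 0 ≤ powExpCurv n l x := by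
  obtain ⟨h0, h1⟩ := inv_add_one_mem hx
  have h2 : 0 ≤ 1 - (x + 1)⁻¹ := by linarith
  have h3 : 0 ≤ 2 - (x + 1)⁻¹ := by linarith
  unfold powExpCurv
  positivity

/-- For `f = powExp (n + 2) l` the sum of `powExpDeriv2` and `powExpCurv` is `(f')² / f`, written
below as an explicit square, hence nonnegative. -/
lemma abs_powExpDeriv2_le (n : ℕ) (l : ℝ) {x : ℝ} (hx : 0 ≤ x) :
    |powExpDeriv2 n l x| ≤ powExpDeriv2 n l x + 2 * powExpCurv n l x := by
  have h := powExpCurv_nonneg n l hx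
  obtain ⟨h0, h1⟩ := inv_add_one_mem hx
  have h2 : 0 ≤ 1 - (x + 1)⁻¹ := by linarith
  have h3 : 0 ≤ powExpDeriv2 n l x + powExpCurv n l x := by
    have e : powExpDeriv2 n l x + powExpCurv n l x = (1 - (x + 1)⁻¹) ^ n *
        ((n + 2) * (x + 1)⁻¹ ^ 2 - l * (1 - (x + 1)⁻¹)) ^ 2 * Real.exp (-l * x) := by
      rw [powExpDeriv2, powExpCurv]
      ring
    rw [e]
    positivity
  rw [abs_le]
  constructor <;> linarith

/-- In `y = x + 1` one has `(1 - 1/y)^n ≤ exp (-n / y)`. Passing from `n` to `n + 2` costs at most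
`exp 2` because `y ≥ 1`, and the shift in `exp (-l x)` costs `exp l`. -/
lemma powExpCurv_le (n : ℕ) {l : ℝ} {x : ℝ} (hx : 0 ≤ x) :
    powExpCurv n l x ≤ 2 * (n + 2) * Real.exp (2 + l) *
      (((x + 1) ^ 3)⁻¹ * expKernel (n + 2) l (x + 1)) := by
  obtain ⟨h0, h1⟩ := inv_add_one_mem hx
  have h2 : 0 ≤ 1 - (x + 1)⁻¹ := by linarith
  have h3 : (1 - (x + 1)⁻¹) ^ n ≤ Real.exp (-((n + 2) / (x + 1))) * Real.exp 2 := by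
    calc (1 - (x + 1)⁻¹) ^ n ≤ Real.exp (-(x + 1)⁻¹) ^ n := by
          gcongr
          exact Real.one_sub_le_exp_neg _
      _ = Real.exp (-(n * (x + 1)⁻¹)) := by rw [← Real.exp_nat_mul]; ring_nf
      _ ≤ Real.exp (-((n + 2) / (x + 1)) + 2) := by
          rw [Real.exp_le_exp, div_eq_mul_inv]
          linarith
      _ = _ := Real.exp_add _ _
  have h4 : Real.exp (-l * x) = Real.exp l * Real.exp (-l * (x + 1)) := by
    rw [← Real.exp_add]; ring_nf
  rw [powExpCurv, expKernel_eq, h4, Real.exp_add, ← inv_pow]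
  calc _ ≤ ((n : ℝ) + 2) * 2 * (x + 1)⁻¹ ^ 3 * (Real.exp (-((n + 2) / (x + 1))) * Real.exp 2) *
        (Real.exp l * Real.exp (-l * (x + 1))) := by
        gcongr
        linarith
    _ = _ := by ring

lemma powExpDeriv_nonpos {n : ℕ} {l : ℝ} (hl : 1 / 2 ≤ l) {x : ℝ} (hx : (n : ℝ) + 2 ≤ x) :
    powExpDeriv n l x ≤ 0 := by
  have hn : (0 : ℝ) ≤ n := Nat.cast_nonneg n
  have hx0 : 0 ≤ x := by linarith
  obtain ⟨h0, h1⟩ := inv_add_one_mem hx0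
  have h2 : 0 ≤ 1 - (x + 1)⁻¹ := by linarith
  have h3 : ((n : ℝ) + 2) * (x + 1)⁻¹ ^ 2 ≤ l * (1 - (x + 1)⁻¹) := by
    have hu : (x + 1)⁻¹ * (x + 1) = 1 := inv_mul_cancel₀ (by positivity)
    have hu3 : (x + 1)⁻¹ ≤ 1 / 2 := by
      rw [← one_div]; exact one_div_le_one_div_of_le two_pos (by linarith)
    have h4 : ((n : ℝ) + 2) * (x + 1)⁻¹ ≤ 1 - (x + 1)⁻¹ := by nlinarith
    nlinarith
  have e : powExpDeriv n l x = ((n + 2) * (x + 1)⁻¹ ^ 2 - l * (1 - (x + 1)⁻¹)) *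
      ((1 - (x + 1)⁻¹) ^ (n + 1) * Real.exp (-l * x)) := by
    rw [powExpDeriv]; ring
  rw [e]
  exact mul_nonpos_of_nonpos_of_nonneg (by linarith) (by positivity)

lemma neg_powExpDeriv_le (n : ℕ) (l : ℝ) {x : ℝ} (hx : 0 ≤ x) :
    -powExpDeriv n l x ≤ l * powExp (n + 2) l x := by
  obtain ⟨h0, h1⟩ := inv_add_one_mem hx
  have h2 : 0 ≤ 1 - (x + 1)⁻¹ := by linarith
  rw [powExp, powExpDeriv, div_add_one_eq (by positivity)]
  have : 0 ≤ ((n : ℝ) + 2) * (x + 1)⁻¹ ^ 2 * (1 - (x + 1)⁻¹) ^ (n + 1) * Real.exp (-l * x) := by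
    positivity
  linarith

lemma powExp_le_half_pow (L : ℕ) {l x : ℝ} (hl : 0 ≤ l) (hx : 0 ≤ x) (hx1 : x ≤ 1) :
    powExp L l x ≤ (1 / 2) ^ L := by
  have h1 : x / (x + 1) ≤ 1 / 2 := by
    rw [div_le_div_iff₀ (by positivity) two_pos]; linarith
  have h2 : Real.exp (-l * x) ≤ 1 := Real.exp_le_one_iff.2 (by nlinarith)
  calc powExp L l x ≤ (1 / 2) ^ L * 1 := by unfold powExp; gcongr
    _ = _ := mul_one _

lemma integral_powExpCurv_le {n : ℕ} {l : ℝ} (hl : 0 < l) (hm : 2 ≤ √((n + 2) * l)) {t : ℝ}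
    (ht : 0 ≤ t) (N : ℕ) :
    ∫ x in t..t + N, powExpCurv n l x ≤ 2 * (n + 2) * Real.exp (2 + l) *
      ∫ y in Ioi 0, (y ^ 3)⁻¹ * expKernel (n + 2) l y := by
  have hK := integrableOn_inv_cube_mul_expKernel (A := (n : ℝ) + 2) (by positivity) hl hm
  have hle : t ≤ t + N := by have := Nat.cast_nonneg (α := ℝ) N; linarith
  have hsub : Ioc (t + 1) (t + N + 1) ⊆ Ioi 0 := fun x hx => lt_trans (by positivity) hx.1
  have hi : IntervalIntegrable (fun y => (y ^ 3)⁻¹ * expKernel (n + 2) l y) volume (t + 1)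
      (t + N + 1) :=
    (intervalIntegrable_iff_integrableOn_Ioc_of_le (by linarith)).2 (hK.mono_set hsub)
  have hi' : IntervalIntegrable (fun x => ((x + 1) ^ 3)⁻¹ * expKernel (n + 2) l (x + 1)) volume t
      (t + N) := by
    simpa using hi.comp_add_right 1
  have hg : IntervalIntegrable (powExpCurv n l) volume t (t + N) :=
    ((continuousOn_powExpCurv n l).mono fun x hx =>
      (le_min ht (ht.trans hle)).trans hx.1).intervalIntegrable
  refine (intervalIntegral.integral_mono_on hle hg (hi'.const_mul _)
    fun x hx => powExpCurv_le n (ht.trans hx.1)).trans ?_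
  rw [intervalIntegral.integral_const_mul,
    intervalIntegral.integral_comp_add_right (fun y => (y ^ 3)⁻¹ * expKernel (n + 2) l y),
    intervalIntegral.integral_of_le (by linarith)]
  refine mul_le_mul_of_nonneg_left ?_ (by positivity)
  refine setIntegral_mono_set hK ?_ hsub.eventuallyLE
  filter_upwards [ae_restrict_mem measurableSet_Ioi] with y hy
  have : (0 : ℝ) < y := hy
  have := expKernel_pos (n + 2) l y
  positivity

lemma exp_neg_log_two_mul (N : ℕ) : Real.exp (-Real.log 2 * N) = (1 / 2) ^ N := by
  rw [Real.exp_mul, Real.exp_neg, Real.exp_log two_pos, Real.rpow_natCast, one_div]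

lemma half_lt_log_two : 1 / 2 < Real.log 2 := by linarith [Real.log_two_gt_d9]

lemma log_two_lt_one : Real.log 2 < 1 := by linarith [Real.log_two_lt_d9]

lemma powExp_le_of_le (L : ℕ) {x : ℝ} {N : ℕ} (hx : (N : ℝ) ≤ x) :
    powExp L (Real.log 2) x ≤ (1 / 2) ^ N := by
  rw [← exp_neg_log_two_mul]
  refine (powExp_le_exp L _ ((Nat.cast_nonneg N).trans hx)).trans (Real.exp_le_exp.2 ?_)
  have := half_lt_log_two
  nlinarith

lemma abs_integral_powExp_sub_intervalIntegral_le (L N : ℕ) {t : ℝ} (ht : 0 ≤ t) (ht1 : t ≤ 1) :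
    |(∫ x in t..t + N, powExp L (Real.log 2) x) - ∫ x in Ioi 0, powExp L (Real.log 2) x| ≤
      (1 / 2) ^ L + 2 * (1 / 2) ^ N := by
  have hl := half_lt_log_two
  have hN := Nat.cast_nonneg (α := ℝ) N
  have hi := integrableOn_powExp L (l := Real.log 2) (by linarith)
  have h1 := intervalIntegral.integral_Ioi_sub_Ioi hi ht
  have hi2 : IntegrableOn (powExp L (Real.log 2)) (Ioi t) := hi.mono_set (Ioi_subset_Ioi ht)
  have h2 := intervalIntegral.integral_Ioi_sub_Ioi hi2 (show t ≤ t + N by linarith)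
  have hi3 : IntegrableOn (powExp L (Real.log 2)) (Ioi (t + N)) :=
    hi2.mono_set (Ioi_subset_Ioi (by linarith))
  have h3 : ∫ x in (0 : ℝ)..t, powExp L (Real.log 2) x ≤ (1 / 2) ^ L := by
    have := intervalIntegral.integral_mono_on ht
      ((intervalIntegrable_iff_integrableOn_Ioc_of_le ht).2 (hi.mono_set Ioc_subset_Ioi_self))
      (intervalIntegrable_const (c := ((1 : ℝ) / 2) ^ L))
      (fun x hx => powExp_le_half_pow L (l := Real.log 2) (by linarith) hx.1 (hx.2.trans ht1))
    refine this.trans ?_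
    rw [intervalIntegral.integral_const, smul_eq_mul, sub_zero]
    exact mul_le_of_le_one_left (by positivity) ht1
  have h4 : 0 ≤ ∫ x in (0 : ℝ)..t, powExp L (Real.log 2) x :=
    intervalIntegral.integral_nonneg ht fun x hx => powExp_nonneg L _ hx.1
  have h5 : 0 ≤ ∫ x in Ioi (t + N), powExp L (Real.log 2) x :=
    setIntegral_nonneg measurableSet_Ioi fun x hx => powExp_nonneg L _
      (by have : t + N < x := hx
          linarith)
  have h6 : ∫ x in Ioi (t + N), powExp L (Real.log 2) x ≤ 2 * (1 / 2) ^ N := by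
    have hneg : -Real.log 2 < 0 := by linarith
    refine (setIntegral_mono_on hi3 (integrableOn_exp_mul_Ioi hneg (t + N)) measurableSet_Ioi
      fun x hx => powExp_le_exp L _ (by have : t + N < x := hx
                                        linarith)).trans ?_
    rw [integral_exp_mul_Ioi hneg, neg_div_neg_eq, div_le_iff₀ (by linarith),
      ← exp_neg_log_two_mul]
    have h7 : Real.exp (-Real.log 2 * (t + N)) ≤ Real.exp (-Real.log 2 * N) :=
      Real.exp_le_exp.2 (by nlinarith)
    have := Real.exp_pos (-Real.log 2 * N)
    nlinarith
  rw [abs_le]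
  have h8 : (0 : ℝ) ≤ (1 / 2) ^ L := by positivity
  have h9 : (0 : ℝ) ≤ (1 / 2) ^ N := by positivity
  constructor <;> linarith

lemma abs_sum_powExp_sub_integral_le {n : ℕ} (hm : 2 ≤ √((n + 2) * Real.log 2)) {t : ℝ}
    (ht : 0 ≤ t) (ht1 : t ≤ 1) :
    |∑ k ∈ Finset.range (n + 2), powExp (n + 2) (Real.log 2) (t + k) -
      ∫ x in Ioi 0, powExp (n + 2) (Real.log 2) x| ≤
      5 * (1 / 2) ^ (n + 2) + (n + 2) * Real.exp 3 *
        ∫ y in Ioi 0, (y ^ 3)⁻¹ * expKernel (n + 2) (Real.log 2) y := by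
  have hl := half_lt_log_two
  have hl1 := log_two_lt_one
  have h1 := abs_sum_sub_integral_le (fun x hx => hasDerivAt_powExp n (Real.log 2) hx)
    (fun x hx => hasDerivAt_powExpDeriv n (Real.log 2) hx) (continuousOn_powExpDeriv2 n _)
    (continuousOn_powExpCurv n _) (fun x hx => abs_powExpDeriv2_le n _ hx) ht (n + 2)
  have h2 := abs_integral_powExp_sub_intervalIntegral_le (n + 2) (n + 2) ht ht1
  have h3 := integral_powExpCurv_le (l := Real.log 2) (by linarith) hm ht (n + 2)
  -- The right end lies beyond the maximum of `powExp`, so the telescoped difference of derivatives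
  -- is at most `-f' t ≤ l f t`, which is exponentially small.
  have h4 := powExpDeriv_nonpos (n := n) hl.le (x := t + (n + 2 : ℕ)) (by push_cast; linarith)
  have h5 := neg_powExpDeriv_le n (Real.log 2) ht
  have h6 := powExp_le_half_pow (n + 2) (l := Real.log 2) (by linarith) ht ht1
  have h7 := powExp_le_of_le (n + 2) (x := t + (n + 2 : ℕ)) (N := n + 2) (by linarith)
  have h8 := powExp_nonneg (n + 2) (Real.log 2) ht
  have h9 := powExp_nonneg (n + 2) (Real.log 2) (x := t + (n + 2 : ℕ)) (by positivity)
  have hK : 0 ≤ ∫ y in Ioi 0, (y ^ 3)⁻¹ * expKernel (n + 2) (Real.log 2) y :=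
    setIntegral_nonneg measurableSet_Ioi fun y hy => by
      have : (0 : ℝ) < y := hy
      have := expKernel_pos (n + 2) (Real.log 2) y
      positivity
  have h10 : 2 * ((n : ℝ) + 2) * Real.exp (2 + Real.log 2) *
      (∫ y in Ioi 0, (y ^ 3)⁻¹ * expKernel (n + 2) (Real.log 2) y) ≤ 2 * ((n : ℝ) + 2) *
        Real.exp 3 * ∫ y in Ioi 0, (y ^ 3)⁻¹ * expKernel (n + 2) (Real.log 2) y := by
    gcongr
    linarith
  have h11 : 0 ≤ ((n : ℝ) + 2) * Real.exp 3 *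
      ∫ y in Ioi 0, (y ^ 3)⁻¹ * expKernel (n + 2) (Real.log 2) y := by positivity
  have h12 : Real.log 2 * powExp (n + 2) (Real.log 2) t ≤ 1 * powExp (n + 2) (Real.log 2) t := by
    gcongr
  rw [abs_le] at h1 h2 ⊢
  constructor <;> linarith [h1.1, h1.2, h2.1, h2.2]

/-- `dF` is unfolded into `L` translates of `d?`; the lattice sum is then within a uniform error of
an integral that does not depend on `x`, and `2^x / 2` integrates to `log 2 * c0`. The omitted tail
has mass `(1 / 2)^L`. -/
lemma abs_moment_sub_le {n : ℕ} (hm : 2 ≤ √((n + 2) * Real.log 2)) :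
    |moment (n + 2) - Real.log 2 * c0 * ∫ x in Ioi 0, powExp (n + 2) (Real.log 2) x| ≤
      6 * (1 / 2) ^ (n + 2) + (n + 2) * Real.exp 3 *
        ∫ y in Ioi 0, (y ^ 3)⁻¹ * expKernel (n + 2) (Real.log 2) y := by
  set L := n + 2 with hL
  set J := ∫ x in Ioi 0, powExp L (Real.log 2) x
  set E := 5 * (1 / 2) ^ L + ((n : ℝ) + 2) * Real.exp 3 *
        ∫ y in Ioi 0, (y ^ 3)⁻¹ * expKernel (n + 2) (Real.log 2) y with hE
  have hmh : Measurable fun x : ℝ => (x / (x + 1)) ^ L := by fun_prop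
  have hb : ∀ x : ℝ, 0 < x → |(x / (x + 1)) ^ L| ≤ 1 := fun x hx => by
    rw [abs_of_nonneg (by positivity)]
    refine pow_le_one₀ (by positivity) ?_
    rw [div_le_one (by positivity)]
    linarith
  obtain ⟨-, h⟩ := integral_measureF_eq_sum hmh (integrable_measureF_of_bound hmh hb) L
  -- The weight `2^(-k-1)` is `2^x / 2` times `2^(-(x + k))`, and the second factor belongs to
  -- `powExp`.
  have hterm : ∀ (k : ℕ) (x : ℝ), (1 / 2) ^ (k + 1) * ((x + k) / (x + k + 1)) ^ L =
      (2 : ℝ) ^ x / 2 * powExp L (Real.log 2) (x + k) := fun k x => by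
    rw [powExp, mul_add, Real.exp_add, exp_neg_log_two_mul, neg_mul, Real.exp_neg, Real.exp_mul,
      Real.exp_log two_pos]
    field_simp
    ring
  have hint : ∀ k : ℕ, Integrable (fun x : ℝ => (2 : ℝ) ^ x / 2 * powExp L (Real.log 2) (x + k))
      muQ := fun k => by
    simp only [← hterm]
    refine integrable_muQ_of_bound (by fun_prop) (B := 1) fun x h0 _ => ?_
    rw [abs_mul, abs_of_nonneg (by positivity)]
    exact mul_le_one₀ (pow_le_one₀ (by norm_num) (by norm_num)) (abs_nonneg _)
      (hb (x + k) (by positivity))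
  have e1 : ∑ k ∈ Finset.range L, (1 / 2) ^ (k + 1) * ∫ x, ((x + k) / (x + k + 1)) ^ L ∂muQ =
      ∫ x, (2 : ℝ) ^ x / 2 * ∑ k ∈ Finset.range L, powExp L (Real.log 2) (x + k) ∂muQ := by
    simp only [Finset.mul_sum]
    rw [integral_finsetSum _ fun k _ => hint k]
    refine Finset.sum_congr rfl fun k _ => ?_
    rw [← integral_const_mul]
    simp only [hterm]
  have hi1 : Integrable (fun x : ℝ => (2 : ℝ) ^ x / 2 *
      ∑ k ∈ Finset.range L, powExp L (Real.log 2) (x + k)) muQ := by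
    simp only [Finset.mul_sum]
    exact integrable_finsetSum _ fun k _ => hint k
  have hi2 : Integrable (fun x : ℝ => (2 : ℝ) ^ x / 2 * J) muQ :=
    integrable_muQ_of_continuous
      (((Real.continuous_const_rpow two_ne_zero).div_const 2).mul_const J)
  have e2 : Real.log 2 * c0 * J = ∫ x, (2 : ℝ) ^ x / 2 * J ∂muQ := by
    rw [integral_mul_const, integral_div, log_two_mul_c0]
  have h1 : |∫ x, ((2 : ℝ) ^ x / 2 * ∑ k ∈ Finset.range L, powExp L (Real.log 2) (x + k) -
      (2 : ℝ) ^ x / 2 * J) ∂muQ| ≤ E := by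
    have := norm_integral_le_of_norm_le_const (μ := muQ) (C := E)
      (f := fun x => (2 : ℝ) ^ x / 2 * ∑ k ∈ Finset.range L, powExp L (Real.log 2) (x + k) -
      (2 : ℝ) ^ x / 2 * J) ?_
    · simpa using this
    · filter_upwards [ae_muQ] with x hx
      have h2 : (2 : ℝ) ^ x ≤ 2 ^ (1 : ℝ) := Real.rpow_le_rpow_of_exponent_le one_le_two hx.2.le
      rw [Real.rpow_one] at h2
      rw [← mul_sub, norm_mul, Real.norm_of_nonneg (by positivity), Real.norm_eq_abs]
      have h3 := abs_sum_powExp_sub_integral_le hm hx.1.le hx.2.le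
      refine le_trans ?_ h3
      exact mul_le_of_le_one_left (abs_nonneg _) (by linarith)
  have h2 : |∫ x, ((x + L) / (x + L + 1)) ^ L ∂measureF| ≤ 1 := by
    have := norm_integral_le_of_norm_le_const (μ := measureF) (C := 1)
      (f := fun x : ℝ => ((x + L) / (x + L + 1)) ^ L) ?_
    · simpa using this
    · filter_upwards [ae_measureF_pos] with x hx
      exact hb (x + L) (by positivity)
  rw [moment_eq_integral_measureF, h, e1, e2, add_sub_right_comm, ← integral_sub hi1 hi2]
  have h3 : (0 : ℝ) < (1 / 2) ^ L := by positivity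
  calc _ ≤ E + (1 / 2) ^ L * 1 := by
        refine (abs_add_le _ _).trans (add_le_add h1 ?_)
        rw [abs_mul, abs_of_pos h3]
        gcongr
    _ = _ := by rw [hE]; ring

/-! ### Assembly of the asymptotic formula -/

lemma C_rpow_sqrt (x : ℝ) : C ^ √x = Real.exp (-(2 * (√(Real.log 2) * √x))) := by
  rw [C, ← Real.exp_mul]
  ring_nf

/-- `2 ^ (-q ^ 4)` is small against `exp (-2 s) / q` with `s = √(log 2) q ^ 2`. -/
lemma exp_neg_sq_le {q s : ℝ} (hq : 0 < q) (hs : 3 * q ^ 2 / 4 ≤ s) :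
    Real.exp (-s ^ 2) ≤ 8 * (Real.exp (-(2 * s)) * q⁻¹) := by
  have hs0 : 0 ≤ s := le_trans (by positivity) hs
  -- From `-s² = -(s - 1)² - 2 s + 1` and `1 + t ≤ exp t`; the quadratic factor gained here pays for
  -- `q`.
  have h1 : (1 + (s - 1) ^ 2) * Real.exp (-s ^ 2) ≤ Real.exp 1 * Real.exp (-(2 * s)) := by
    have := Real.add_one_le_exp ((s - 1) ^ 2)
    calc _ ≤ Real.exp ((s - 1) ^ 2) * Real.exp (-s ^ 2) := by gcongr; linarith
      _ = _ := by rw [← Real.exp_add, ← Real.exp_add]; ring_nf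
  have he : Real.exp 1 < 2.72 := by linarith [Real.exp_one_lt_d9]
  have h2 : q ≤ 2.9 * (1 + (s - 1) ^ 2) := by nlinarith [sq_nonneg (q - 1), sq_nonneg (s - 1.1)]
  have hE := Real.exp_pos (-s ^ 2)
  have hE2 := Real.exp_pos (-(2 * s))
  rw [← mul_assoc, ← div_eq_mul_inv, le_div_iff₀ hq]
  nlinarith

lemma sqrt_pi_div_eq {q c : ℝ} (hq : 0 < q) : √(c / q ^ 2) = √c / q := by
  rw [Real.sqrt_div' _ (by positivity), Real.sqrt_sq hq.le]

lemma pow_four_rpow_quarter {x : ℝ} (hx : 0 ≤ x) : (x ^ 4) ^ (1 / 4 : ℝ) = x := by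
  have := Real.pow_rpow_inv_natCast hx (n := 4) (by norm_num)
  norm_num at this ⊢
  exact this

lemma four_pi_sq_log_two_rpow :
    (4 * Real.pi ^ 2 * Real.log 2) ^ (1 / 4 : ℝ) =
      2 * √(Real.pi / (2 * √(Real.log 2))) * √(Real.log 2) := by
  have hl : 0 < Real.log 2 := Real.log_pos one_lt_two
  have hr := Real.sq_sqrt hl.le
  have hr0 : 0 < √(Real.log 2) := Real.sqrt_pos.2 hl
  have hb := Real.sq_sqrt (show 0 ≤ Real.pi / (2 * √(Real.log 2)) by positivity)
  rw [← pow_four_rpow_quarter (x := 2 * √(Real.pi / (2 * √(Real.log 2))) * √(Real.log 2))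
    (by positivity)]
  congr 1
  calc 4 * Real.pi ^ 2 * Real.log 2 = 4 * Real.pi ^ 2 * √(Real.log 2) ^ 2 := by rw [hr]
    _ = 16 * (Real.pi / (2 * √(Real.log 2))) ^ 2 * √(Real.log 2) ^ 4 := by field_simp; ring
    _ = 16 * (√(Real.pi / (2 * √(Real.log 2))) ^ 2) ^ 2 * √(Real.log 2) ^ 4 := by rw [hb]
    _ = _ := by ring

/-- The explicit form of the asymptotic formula, with `q = L ^ (1/4)` and
`s = √(L log 2)`. -/
lemma abs_moment_sub_main_le {n : ℕ} {q : ℝ} (hq : 0 < q) (hq4 : (n : ℝ) + 2 = q ^ 4)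
    (hm : 2 ≤ √(Real.log 2) * q ^ 2) :
    |moment (n + 2) - 2 * √(Real.pi / (2 * √(Real.log 2))) * √(Real.log 2) * c0 * q *
      Real.exp (-(2 * (√(Real.log 2) * q ^ 2)))| ≤
      (48 + 8 * Real.exp 3 * √(Real.pi / (2 * √(Real.log 2))) + |Real.log 2 * c0| *
        (√2 * (16 * √(Real.pi / (2 * √(Real.log 2))) +
          √(Real.pi / (2 * √(Real.log 2))) / Real.log 2))) *
        (q⁻¹ * Real.exp (-(2 * (√(Real.log 2) * q ^ 2)))) := by
  have hl := half_lt_log_two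
  have hl1 := log_two_lt_one
  have hl0 : 0 < Real.log 2 := by linarith
  set l := Real.log 2 with hldef
  set β := √(Real.pi / (2 * √l)) with hβ
  have hr := Real.sq_sqrt hl0.le
  have hr0 : 0 < √l := Real.sqrt_pos.2 hl0
  have hr34 : 3 / 4 ≤ √l := Real.le_sqrt_of_sq_le (by
    have := Real.log_two_gt_d9
    rw [hldef]; norm_num; linarith)
  have hβ0 : 0 ≤ β := Real.sqrt_nonneg _
  have hA : (0 : ℝ) < n + 2 := by positivity
  have hS : √(((n : ℝ) + 2) * l) = √l * q ^ 2 := by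
    rw [hq4, mul_comm, Real.sqrt_mul hl0.le, show q ^ 4 = (q ^ 2) ^ 2 by ring,
      Real.sqrt_sq (by positivity)]
  have ha : √(((n : ℝ) + 2) / l) = q ^ 2 / √l := by
    rw [hq4, Real.sqrt_div (by positivity), show q ^ 4 = (q ^ 2) ^ 2 by ring,
      Real.sqrt_sq (by positivity)]
  have hm' : 2 ≤ √(((n : ℝ) + 2) * l) := by rwa [hS]
  have hm'' : 2 ≤ √(((n + 2 : ℕ) : ℝ) * l) := by push_cast; exact hm'
  have h1 := abs_moment_sub_le hm'
  have h2 := abs_integral_powExp_sub_le (n + 2) (by omega) hl0 hm''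
  have h3 := abs_integral_expKernel_sub_le hA hl0 hm'
  have h4 := integral_inv_cube_mul_expKernel_le hA hl0 hm'
  push_cast at h2
  have hE : Real.exp (l / 2) = √2 := by rw [Real.exp_half, hldef, Real.exp_log two_pos]
  have e1 : √(Real.pi / (2 * (√l * q ^ 2))) = β / q := by
    rw [← mul_assoc, ← div_div, sqrt_pi_div_eq hq]
  have hs2 := Real.sq_sqrt (show (0 : ℝ) ≤ 2 by norm_num)
  have hs20 : 0 < √(2 : ℝ) := by positivity
  -- This `1 / √2` cancels the `√2 = exp (l / 2)` produced by the shift by `1 / 2`.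
  have e2 : √(Real.pi / (4 * (√l * q ^ 2))) = β / q / √2 := by
    rw [← e1, ← Real.sqrt_div (by positivity)]
    congr 1
    field_simp
    norm_num
  have hpow : ((1 : ℝ) / 2) ^ (n + 2) = Real.exp (-(√l * q ^ 2) ^ 2) := by
    rw [← exp_neg_log_two_mul, mul_pow, hr, ← hldef]
    push_cast
    rw [hq4]
    ring_nf
  have h5 := exp_neg_sq_le hq (s := √l * q ^ 2) (by nlinarith [sq_nonneg q])
  rw [← hpow] at h5
  rw [hS, ha, e2, e1] at h3
  rw [hS, e1] at h4
  rw [hE] at h2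
  set e := Real.exp (-(2 * (√l * q ^ 2))) with he
  have he0 : 0 < e := Real.exp_pos _
  set J := ∫ x in Ioi 0, powExp (n + 2) l x
  set I := ∫ y in Ioi 0, expKernel (n + 2) l y
  set K := ∫ y in Ioi 0, (y ^ 3)⁻¹ * expKernel (n + 2) l y
  have hLK : ((n : ℝ) + 2) * K ≤ 8 * β * (q⁻¹ * e) := by
    calc ((n : ℝ) + 2) * K ≤ (n + 2) * (l / (n + 2) * e * (8 * (β / q))) := by gcongr
      _ = l * (8 * β * (q⁻¹ * e)) := by field_simp
      _ ≤ 1 * (8 * β * (q⁻¹ * e)) := by gcongr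
      _ = _ := one_mul _
  have hK0 : 0 ≤ K := setIntegral_nonneg measurableSet_Ioi fun y hy => by
      have : (0 : ℝ) < y := hy
      have := expKernel_pos (n + 2) l y
      positivity
  have h6 : |moment (n + 2) - l * c0 * J| ≤ (48 + 8 * Real.exp 3 * β) * (q⁻¹ * e) := by
    refine h1.trans ?_
    have : Real.exp 3 * (((n : ℝ) + 2) * K) ≤ Real.exp 3 * (8 * β * (q⁻¹ * e)) := by gcongr
    linarith
  have h7 : |J - √2 * I| ≤ √2 * (16 * β) * (q⁻¹ * e) := by
    refine h2.trans ?_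
    have : (1 + ((n : ℝ) + 2)) * K ≤ 16 * β * (q⁻¹ * e) := by
      have : 0 ≤ (n : ℝ) * K := by positivity
      linarith
    calc √2 * ((1 + ((n : ℝ) + 2)) * K) ≤ √2 * (16 * β * (q⁻¹ * e)) := by gcongr
      _ = _ := by ring
  have h8 : |√2 * I - 2 * β / √l * q * e| ≤ √2 * (β / l) * (q⁻¹ * e) := by
    have e3 : √2 * I - 2 * β / √l * q * e = √2 * (I - q ^ 2 / √l * e * (2 * (β / q / √2))) := by
      field_simp
    rw [e3, abs_mul, abs_of_pos hs20, mul_assoc √2 (β / l)]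
    refine mul_le_mul_of_nonneg_left (h3.trans_eq ?_) hs20.le
    have : β / l = β / √l ^ 2 := by rw [hr]
    rw [this]
    field_simp
  have h9 : |J - 2 * β / √l * q * e| ≤ √2 * (16 * β + β / l) * (q⁻¹ * e) := by
    have := abs_sub_le J (√2 * I) (2 * β / √l * q * e)
    linarith
  have e4 : moment (n + 2) - 2 * β * √l * c0 * q * e =
      (moment (n + 2) - l * c0 * J) + l * c0 * (J - 2 * β / √l * q * e) := by
    have : l * c0 * (2 * β / √l * q * e) = 2 * β * √l * c0 * q * e := by
      have h10 : l / √l = √l := by rw [div_eq_iff hr0.ne', ← sq, hr]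
      linear_combination 2 * β * c0 * q * e * h10
    linear_combination this
  rw [e4]
  calc _ ≤ (48 + 8 * Real.exp 3 * β) * (q⁻¹ * e) +
        |l * c0| * (√2 * (16 * β + β / l) * (q⁻¹ * e)) := by
        refine (abs_add_le _ _).trans (add_le_add h6 ?_)
        rw [abs_mul]
        gcongr
    _ = _ := by ring

theorem moment_asymptotics :
    (fun L : ℕ => moment L - (4 * Real.pi ^ 2 * Real.log 2) ^ (1 / 4 : ℝ) * c0 *
        (L : ℝ) ^ (1 / 4 : ℝ) * C ^ √(L : ℝ))
      =O[atTop] (fun L : ℕ => (L : ℝ) ^ (-1 / 4 : ℝ) * C ^ √(L : ℝ)) := by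
  refine IsBigO.of_bound (48 + 8 * Real.exp 3 * √(Real.pi / (2 * √(Real.log 2))) +
    |Real.log 2 * c0| * (√2 * (16 * √(Real.pi / (2 * √(Real.log 2))) +
          √(Real.pi / (2 * √(Real.log 2))) / Real.log 2))) ?_
  -- `L ≥ 8` and `log 2 > 1 / 2` give `√(L log 2) ≥ 2`, as the Gaussian estimates require.
  filter_upwards [eventually_ge_atTop 8] with L hL
  obtain ⟨n, rfl⟩ : ∃ n, L = n + 2 := ⟨L - 2, by omega⟩
  have hL0 : (0 : ℝ) < ((n + 2 : ℕ) : ℝ) := by positivity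
  set q : ℝ := ((n + 2 : ℕ) : ℝ) ^ (1 / 4 : ℝ) with hqdef
  have hq : 0 < q := by positivity
  have hq4 : ((n + 2 : ℕ) : ℝ) = q ^ 4 := by
    rw [hqdef, ← Real.rpow_natCast, ← Real.rpow_mul hL0.le]
    norm_num
  have hq2 : √((n + 2 : ℕ) : ℝ) = q ^ 2 := by
    rw [hq4, show q ^ 4 = (q ^ 2) ^ 2 by ring, Real.sqrt_sq (by positivity)]
  have hqi : ((n + 2 : ℕ) : ℝ) ^ (-1 / 4 : ℝ) = q⁻¹ := by
    rw [neg_div, Real.rpow_neg hL0.le]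
  have hm : 2 ≤ √(Real.log 2) * q ^ 2 := by
    rw [← hq2, ← Real.sqrt_mul (Real.log_pos one_lt_two).le]
    refine Real.le_sqrt_of_sq_le ?_
    have h1 : (8 : ℝ) ≤ ((n + 2 : ℕ) : ℝ) := by exact_mod_cast hL
    have := half_lt_log_two
    nlinarith
  have h := abs_moment_sub_main_le (n := n) hq (by rw [← hq4]; push_cast; rfl) hm
  rw [hqi, C_rpow_sqrt, hq2, four_pi_sq_log_two_rpow, Real.norm_eq_abs, Real.norm_of_nonneg
    (by positivity)]
  exact h

/-! ### Integer certificate for the digits of `c0` -/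

/-- The fixed point approximation of `2 ^ 200 * sReal k`. -/
def sFix (k : ℕ) : ℕ :=
  ∑ n ∈ Finset.range 50, 2 ^ (200 + k) / (2 ^ (n + 1) * (2 * n + 3) ^ k)

/-- The fixed point coefficient of the central moment of order `2 h` in the relation between the
moments that the expansion of `x ^ (m + 1)` along the branches of the Gauss map gives. -/
def dFix (m h : ℕ) : ℤ :=
  (((m + 1).descFactorial (2 * h) / (2 * h).factorial * 2 ^ (200 - (m + 1 - 2 * h)) : ℕ) : ℤ) -
    (((2 * h + 1).ascFactorial m / m.factorial * sFix (m + 1 + 2 * h) : ℕ) : ℤ)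

/-- The multipliers of these relations, times `10 ^ 18`. -/
def certCoeff (m : ℕ) : ℤ :=
  [-732654804960056665, 197805024439758748, 9822580647515395, -43460747980752116,
    29281852861676351, -15430952877931386, 7537829673477575, -3227520344147496, 1126995208690145,
    -308556506929713, 59956129788481, -6002749602188].getD m 0

/-- The numbers `(log 2) ^ (2 h) / (2 h)!` for `h < 8`, times `10 ^ 24`. -/
def coshCoeff (h : ℕ) : ℤ :=
  [1000000000000000000000000, 240226506959100712333551, 9618129107628477161979,
    154035303933816099544, 1321548679014430949, 7054911620801123, 25678435993488,
    67787263548].getD h 0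

/-- The coefficient that is left at the central moment of order `2 h`. -/
def residFix (h : ℕ) : ℤ :=
  coshCoeff h * 2 ^ 200 - 10 ^ 6 * ∑ m ∈ Finset.range 12, certCoeff m * dFix m h

/-- Since the central moment of order `2 h` is at most `4^(-h)`, this bounds the contribution of all
orders `2, ..., 58`; the powers of `4` are cleared by the factor `4^29`. -/
lemma sum_abs_residFix_le :
    ∑ h ∈ Finset.range 29, |residFix (h + 1)| * 4 ^ (28 - h) ≤ 4 ^ 29 * 2 ^ 200 * 4 * 10 ^ 9 := by
  decide +kernel

/-- The zeroth central moment is `1`, so this coefficient, divided by `10^24 * 2^200`, is the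
approximate value of `∫ exp (log 2 * (x - 1/2)) d?`. -/
lemma residFix_zero_mem : 10098615114036281544 * 10 ^ 5 * 2 ^ 200 ≤ residFix 0 ∧
    residFix 0 ≤ 10098615114036281545 * 10 ^ 5 * 2 ^ 200 := by
  decide +kernel


/-! ### Linear relations between the central moments of `d?` -/

/-- Binomial series in `r = -v / c` with `|r| ≤ 1 / 3`. Writing `1 / 3 = (2 / 3) (1 / 2)` extracts
`(1 / 2)^I` from the tail, and the full series at `2 / 3` sums to `3^(m+1)`. Together with `c⁻¹ ≤ 2
/ 3` this gives `2^(m+1)`. -/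
lemma abs_inv_pow_sub_sum_le {c v : ℝ} (hc : 3 / 2 ≤ c) (hv : |v| ≤ 1 / 2) (m I : ℕ) :
    |((c + v) ^ (m + 1))⁻¹ -
      ∑ i ∈ Finset.range I, (-1) ^ i * ((i + m).choose m) * (c ^ (m + 1 + i))⁻¹ * v ^ i| ≤
      (1 / 2) ^ I * 2 ^ (m + 1) := by
  have hc0 : 0 < c := by linarith
  set r : ℝ := -v / c with hr
  have hr1 : |r| ≤ 1 / 3 := by
    rw [hr, abs_div, abs_neg, abs_of_pos hc0, div_le_iff₀ hc0]
    linarith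
  have hcv : c + v = c * (1 - r) := by rw [hr]; field_simp; ring
  have h := hasSum_choose_mul_geometric_of_norm_lt_one m (r := r)
    (by rw [Real.norm_eq_abs]; linarith)
  have hg := hasSum_choose_mul_geometric_of_norm_lt_one m (r := (2 / 3 : ℝ)) (by norm_num)
  have h' := (hasSum_nat_add_iff' I).2 h
  have hg' := (hasSum_nat_add_iff' I).2 hg
  have hb := tsum_of_norm_bounded (hg'.mul_left ((1 / 2) ^ I)) (f := fun i =>
    ((i + I + m).choose m : ℝ) * r ^ (i + I)) (fun i => by
      rw [norm_mul, norm_pow, Real.norm_natCast, Real.norm_eq_abs]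
      have h1 : |r| ^ (i + I) ≤ (2 / 3) ^ (i + I) * (1 / 2) ^ I := by
        calc |r| ^ (i + I) ≤ (1 / 3) ^ (i + I) := by gcongr
          _ = (2 / 3) ^ (i + I) * (1 / 2) ^ (i + I) := by rw [← mul_pow]; norm_num
          _ ≤ _ := by
            gcongr (2 / 3) ^ (i + I) * ?_
            exact pow_le_pow_of_le_one (by norm_num) (by norm_num) (by omega)
      calc _ ≤ ((i + I + m).choose m : ℝ) * ((2 / 3) ^ (i + I) * (1 / 2) ^ I) := by gcongr
        _ = _ := by ring)
  rw [h'.tsum_eq] at hb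
  have hs : (0 : ℝ) ≤ ∑ i ∈ Finset.range I, ((i + m).choose m : ℝ) * (2 / 3) ^ i :=
    Finset.sum_nonneg fun i _ => by positivity
  have hfac : ((c + v) ^ (m + 1))⁻¹ - ∑ i ∈ Finset.range I,
      (-1) ^ i * ((i + m).choose m) * (c ^ (m + 1 + i))⁻¹ * v ^ i =
      (c ^ (m + 1))⁻¹ * (1 / (1 - r) ^ (m + 1) -
        ∑ i ∈ Finset.range I, ((i + m).choose m : ℝ) * r ^ i) := by
    rw [mul_sub, Finset.mul_sum, hcv, mul_pow, mul_inv, one_div]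
    congr 1
    refine Finset.sum_congr rfl fun i _ => ?_
    have hr' : r = -1 * (v * c⁻¹) := by rw [hr, neg_div, div_eq_mul_inv, neg_one_mul]
    rw [hr', mul_pow, mul_pow, inv_pow, pow_add, mul_inv]
    ring
  have hcm : (c ^ (m + 1))⁻¹ ≤ (2 / 3) ^ (m + 1) := by
    rw [← inv_pow]
    gcongr
    rw [inv_le_comm₀ hc0 (by norm_num)]
    linarith
  rw [hfac, abs_mul, abs_of_pos (by positivity), ← Real.norm_eq_abs (_ - _)]
  have h3 : (1 / 2 : ℝ) ^ I * (1 / (1 - 2 / 3) ^ (m + 1) -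
      ∑ i ∈ Finset.range I, ((i + m).choose m : ℝ) * (2 / 3) ^ i) ≤ (1 / 2) ^ I * 3 ^ (m + 1) := by
    gcongr
    have : (1 : ℝ) / (1 - 2 / 3) ^ (m + 1) = 3 ^ (m + 1) := by
      rw [one_div, ← inv_pow]; norm_num
    linarith
  calc _ ≤ (2 / 3 : ℝ) ^ (m + 1) * ((1 / 2) ^ I * 3 ^ (m + 1)) := by
        gcongr
        exact hb.trans h3
    _ = (1 / 2) ^ I * ((2 / 3) * 3) ^ (m + 1) := by rw [mul_pow]; ring
    _ = _ := by norm_num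

/-- The moments of `d?` about the centre `1 / 2`. -/
def centralMoment (i : ℕ) : ℝ := ∫ x, (x - 1 / 2) ^ i ∂muQ

lemma centralMoment_zero : centralMoment 0 = 1 := by simp [centralMoment]

lemma centralMoment_odd (h : ℕ) : centralMoment (2 * h + 1) = 0 := by
  have := integral_muQ_one_sub (h := fun x => (x - 1 / 2) ^ (2 * h + 1)) (by fun_prop)
  have e : ∀ x : ℝ, (1 - x - 1 / 2) ^ (2 * h + 1) = -(x - 1 / 2) ^ (2 * h + 1) := fun x => by
    rw [← Odd.neg_pow ⟨h, rfl⟩]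
    ring_nf
  simp only [e, integral_neg] at this
  rw [centralMoment]
  linarith

lemma ae_muQ_abs_sub_half_le : ∀ᵐ x ∂muQ, |x - 1 / 2| ≤ 1 / 2 := by
  filter_upwards [ae_muQ] with x hx
  rw [abs_le]
  constructor <;> linarith

lemma abs_centralMoment_le (i : ℕ) : |centralMoment i| ≤ (1 / 2) ^ i := by
  have := norm_integral_le_of_norm_le_const (μ := muQ) (C := (1 / 2) ^ i)
    (f := fun x => (x - 1 / 2) ^ i) (by
      filter_upwards [ae_muQ_abs_sub_half_le] with x hx
      rw [norm_pow, Real.norm_eq_abs]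
      gcongr)
  simpa [centralMoment] using this

lemma four_pow_mul_abs_centralMoment_le (h : ℕ) : 4 ^ h * |centralMoment (2 * h)| ≤ 1 := by
  have := abs_centralMoment_le (2 * h)
  calc 4 ^ h * |centralMoment (2 * h)| ≤ 4 ^ h * (1 / 2) ^ (2 * h) := by gcongr
    _ = 1 := by rw [pow_mul, ← mul_pow]; norm_num

lemma integrable_sub_half_pow (i : ℕ) : Integrable (fun x : ℝ => (x - 1 / 2) ^ i) muQ :=
  integrable_muQ_of_continuous (by fun_prop)

lemma sum_mul_centralMoment (a : ℕ → ℝ) (H : ℕ) :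
    ∑ i ∈ Finset.range (2 * H), a i * centralMoment i =
      ∑ h ∈ Finset.range H, a (2 * h) * centralMoment (2 * h) := by
  induction H with
  | zero => simp
  | succ H ih =>
    rw [mul_add, Finset.sum_range_succ _ H, ← ih, mul_one, Finset.sum_range_succ,
      Finset.sum_range_succ, centralMoment_odd, mul_zero, add_zero]

lemma integral_sum_mul_sub_half_pow (a : ℕ → ℝ) (H : ℕ) :
    ∫ x, ∑ i ∈ Finset.range (2 * H), a i * (x - 1 / 2) ^ i ∂muQ =
      ∑ h ∈ Finset.range H, a (2 * h) * centralMoment (2 * h) := by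
  rw [integral_finsetSum _ fun i _ => (integrable_sub_half_pow i).const_mul (a i),
    ← sum_mul_centralMoment]
  simp only [integral_const_mul, centralMoment]

lemma abs_integral_sub_sum_centralMoment_le {f : ℝ → ℝ} (hf : Integrable f muQ) (a : ℕ → ℝ)
    (H : ℕ) {ε : ℝ} (h : ∀ x, 0 ≤ x → |x - 1 / 2| ≤ 1 / 2 →
      |f x - ∑ i ∈ Finset.range (2 * H), a i * (x - 1 / 2) ^ i| ≤ ε) :
    |(∫ x, f x ∂muQ) - ∑ h ∈ Finset.range H, a (2 * h) * centralMoment (2 * h)| ≤ ε := by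
  rw [← integral_sum_mul_sub_half_pow, ← integral_sub hf
    (integrable_finsetSum _ fun i _ => (integrable_sub_half_pow i).const_mul (a i))]
  have := norm_integral_le_of_norm_le_const (μ := muQ) (C := ε)
    (f := fun x => f x - ∑ i ∈ Finset.range (2 * H), a i * (x - 1 / 2) ^ i) (by
      filter_upwards [ae_muQ_abs_sub_half_le, ae_muQ] with x hx hx'
      exact h x hx'.1.le hx)
  simpa using this

lemma integral_pow_muQ (m : ℕ) {H : ℕ} (hH : m + 2 ≤ 2 * H) :
    ∫ x, x ^ (m + 1) ∂muQ = ∑ h ∈ Finset.range H,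
      ((m + 1).choose (2 * h) * (1 / 2) ^ (m + 1 - 2 * h)) * centralMoment (2 * h) := by
  rw [← integral_sum_mul_sub_half_pow
    (fun i => ((m + 1).choose i * (1 / 2) ^ (m + 1 - i) : ℝ))]
  congr 1
  ext x
  have h := add_pow (x - 1 / 2) (1 / 2) (m + 1)
  rw [sub_add_cancel] at h
  rw [h]
  -- Beyond `i = m + 1` the binomial coefficient vanishes, so the truncated subtraction in the
  -- exponent is harmless.
  refine Finset.sum_subset_zero_on_sdiff (Finset.range_subset_range.2 hH) (fun i hi => ?_)
    fun i _ => by ring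
  simp only [Finset.mem_sdiff, Finset.mem_range, not_lt] at hi
  rw [Nat.choose_eq_zero_of_lt (by omega)]
  simp

/-- The sums `∑_{n < 50} 2 ^ (-n - 1) (n + 3 / 2) ^ (-k)`. -/
def sReal (k : ℕ) : ℝ := ∑ n ∈ Finset.range 50, (1 / 2) ^ (n + 1) * ((n + 3 / 2 : ℝ) ^ k)⁻¹

lemma sum_half_pow_succ (K : ℕ) :
    ∑ n ∈ Finset.range K, (1 / 2 : ℝ) ^ (n + 1) = 1 - (1 / 2) ^ K := by
  induction K with
  | zero => simp
  | succ K ih => rw [Finset.sum_range_succ, ih]; ring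

lemma measurable_pow_succ_inv (m : ℕ) (c : ℝ) :
    Measurable fun x : ℝ => ((x + c + 1)⁻¹) ^ (m + 1) := by fun_prop

/-- One relation for each `m`: `x^(m+1)` is expanded about `1 / 2` exactly, each of the first fifty
inverse branches up to order `2 H`, and the remaining branches have total weight `(1 / 2)^50`. -/
lemma abs_sum_coeff_mul_centralMoment_le {m H : ℕ} (hH : m + 2 ≤ 2 * H) :
    |∑ h ∈ Finset.range H, ((m + 1).choose (2 * h) * (1 / 2) ^ (m + 1 - 2 * h) -
      (2 * h + m).choose m * sReal (m + 1 + 2 * h)) * centralMoment (2 * h)| ≤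
      (1 / 2) ^ (2 * H) * 2 ^ (m + 1) + (1 / 2) ^ 50 := by
  have hb01 : ∀ x c : ℝ, 0 ≤ x → 0 ≤ c → ((x + c + 1)⁻¹) ^ (m + 1) ≤ 1 := fun x c hx hc =>
    pow_le_one₀ (by positivity) (inv_le_one_of_one_le₀ (by linarith))
  have hG := integral_muQ_eq_sum (h := fun x => x ^ (m + 1)) (by fun_prop)
    (integrable_muQ_of_continuous (by fun_prop)) 50
  have hn : ∀ n : ℕ, |(∫ x, ((x + n + 1)⁻¹) ^ (m + 1) ∂muQ) - ∑ h ∈ Finset.range H,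
      ((2 * h + m).choose m * ((n + 3 / 2 : ℝ) ^ (m + 1 + 2 * h))⁻¹) * centralMoment (2 * h)| ≤
      (1 / 2) ^ (2 * H) * 2 ^ (m + 1) := fun n => by
    have hi : Integrable (fun x : ℝ => ((x + n + 1)⁻¹) ^ (m + 1)) muQ :=
      integrable_muQ_of_bound (measurable_pow_succ_inv m n) (B := 1) fun x h0 _ => by
        rw [abs_of_nonneg (by positivity)]
        exact hb01 x n h0.le (by positivity)
    have := abs_integral_sub_sum_centralMoment_le hi
      (fun i => (-1) ^ i * ((i + m).choose m) * ((n + 3 / 2 : ℝ) ^ (m + 1 + i))⁻¹) H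
      (ε := (1 / 2) ^ (2 * H) * 2 ^ (m + 1)) (fun x _ hx => by
        have hn0 : (0 : ℝ) ≤ n := Nat.cast_nonneg n
        have := abs_inv_pow_sub_sum_le (c := n + 3 / 2) (by linarith) hx m (2 * H)
        rwa [show (n : ℝ) + 3 / 2 + (x - 1 / 2) = x + n + 1 by ring, ← inv_pow] at this)
    simpa only [pow_mul, neg_one_sq, one_pow, one_mul] using this
  have htail : |∫ x, ((x + (50 : ℕ) + 1)⁻¹) ^ (m + 1) ∂measureF| ≤ 1 := by
    have := norm_integral_le_of_norm_le_const (μ := measureF) (C := 1)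
      (f := fun x : ℝ => ((x + (50 : ℕ) + 1)⁻¹) ^ (m + 1)) (by
        filter_upwards [ae_measureF_pos] with x hx
        rw [Real.norm_of_nonneg (by positivity)]
        exact hb01 x _ hx.le (by positivity))
    simpa using this
  rw [integral_pow_muQ m hH] at hG
  have e : ∑ h ∈ Finset.range H, ((m + 1).choose (2 * h) * (1 / 2) ^ (m + 1 - 2 * h) -
      (2 * h + m).choose m * sReal (m + 1 + 2 * h)) * centralMoment (2 * h) =
      ∑ n ∈ Finset.range 50, (1 / 2) ^ (n + 1) * ((∫ x, ((x + n + 1)⁻¹) ^ (m + 1) ∂muQ) -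
        ∑ h ∈ Finset.range H, ((2 * h + m).choose m * ((n + 3 / 2 : ℝ) ^ (m + 1 + 2 * h))⁻¹) *
          centralMoment (2 * h)) +
      (1 / 2) ^ 50 * ∫ x, ((x + (50 : ℕ) + 1)⁻¹) ^ (m + 1) ∂measureF := by
    simp only [sub_mul, mul_sub, Finset.sum_sub_distrib]
    rw [hG]
    have : ∑ h ∈ Finset.range H, (2 * h + m).choose m * sReal (m + 1 + 2 * h) *
        centralMoment (2 * h) = ∑ n ∈ Finset.range 50, (1 / 2) ^ (n + 1) *
          ∑ h ∈ Finset.range H, ((2 * h + m).choose m *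
            ((n + 3 / 2 : ℝ) ^ (m + 1 + 2 * h))⁻¹) * centralMoment (2 * h) := by
      simp only [sReal, Finset.mul_sum, Finset.sum_mul]
      rw [Finset.sum_comm]
      refine Finset.sum_congr rfl fun n _ => Finset.sum_congr rfl fun h _ => by ring
    rw [this]
    ring
  rw [e]
  refine (abs_add_le _ _).trans (add_le_add ?_ ?_)
  · refine (Finset.abs_sum_le_sum_abs _ _).trans ?_
    calc _ ≤ ∑ n ∈ Finset.range 50, (1 / 2 : ℝ) ^ (n + 1) * ((1 / 2) ^ (2 * H) * 2 ^ (m + 1)) :=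
          Finset.sum_le_sum fun n _ => by
            rw [abs_mul, abs_of_pos (by positivity)]
            gcongr
            exact hn n
      _ = (1 - (1 / 2) ^ 50) * ((1 / 2) ^ (2 * H) * 2 ^ (m + 1)) := by
          rw [← Finset.sum_mul, sum_half_pow_succ]
      _ ≤ _ := mul_le_of_le_one_left (by positivity) (by norm_num)
  · rw [abs_mul, abs_of_pos (by positivity)]
    exact mul_le_of_le_one_right (by positivity) htail

/-- Each of the fifty integer divisions rounds down by at most one unit. -/
lemma sFix_bounds (k : ℕ) : 0 ≤ 2 ^ 200 * sReal k - sFix k ∧ 2 ^ 200 * sReal k - sFix k ≤ 50 := by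
  have h : ∀ n : ℕ, 0 ≤ 2 ^ 200 * ((1 / 2) ^ (n + 1) * ((n + 3 / 2 : ℝ) ^ k)⁻¹) -
      ((2 ^ (200 + k) / (2 ^ (n + 1) * (2 * n + 3) ^ k) : ℕ) : ℝ) ∧
      2 ^ 200 * ((1 / 2) ^ (n + 1) * ((n + 3 / 2 : ℝ) ^ k)⁻¹) -
      ((2 ^ (200 + k) / (2 ^ (n + 1) * (2 * n + 3) ^ k) : ℕ) : ℝ) ≤ 1 := fun n => by
    have e : 2 ^ 200 * ((1 / 2) ^ (n + 1) * ((n + 3 / 2 : ℝ) ^ k)⁻¹) =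
        ((2 ^ (200 + k) : ℕ) : ℝ) / ((2 ^ (n + 1) * (2 * n + 3) ^ k : ℕ) : ℝ) := by
      have : (n + 3 / 2 : ℝ) = (2 * n + 3) / 2 := by ring
      rw [this, one_div, inv_pow, div_pow, pow_add]
      push_cast
      field_simp
      ring
    rw [e]
    refine ⟨sub_nonneg.2 Nat.cast_div_le, ?_⟩
    rw [sub_le_iff_le_add', ← Nat.floor_div_eq_div (K := ℝ)]
    exact (Nat.lt_floor_add_one _).le
  rw [sReal, sFix, Nat.cast_sum, Finset.mul_sum, ← Finset.sum_sub_distrib]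
  refine ⟨Finset.sum_nonneg fun n _ => (h n).1, ?_⟩
  refine (Finset.sum_le_sum fun n _ => (h n).2).trans ?_
  simp

lemma abs_dFix_sub_le {m : ℕ} (hm : m < 12) (h : ℕ) :
    |2 ^ 200 * ((m + 1).choose (2 * h) * (1 / 2) ^ (m + 1 - 2 * h) -
      (2 * h + m).choose m * sReal (m + 1 + 2 * h)) - dFix m h| ≤ 2 ^ 18 * 4 ^ h := by
  have e1 : (m + 1).descFactorial (2 * h) / (2 * h).factorial = (m + 1).choose (2 * h) :=
    (Nat.choose_eq_descFactorial_div_factorial _ _).symm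
  have e2 : (2 * h + 1).ascFactorial m / m.factorial = (2 * h + m).choose m := by
    rw [Nat.ascFactorial_eq_factorial_mul_choose, Nat.mul_div_cancel_left _ m.factorial_pos]
  have e3 : (2 : ℝ) ^ 200 * (1 / 2) ^ (m + 1 - 2 * h) = 2 ^ (200 - (m + 1 - 2 * h)) := by
    rw [one_div, inv_pow, pow_sub₀ (2 : ℝ) two_ne_zero (show m + 1 - 2 * h ≤ 200 by omega)]
  have hs := sFix_bounds (m + 1 + 2 * h)
  rw [dFix, e1, e2]
  push_cast
  have e4 : (2 : ℝ) ^ 200 * ((m + 1).choose (2 * h) * (1 / 2) ^ (m + 1 - 2 * h) -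
      (2 * h + m).choose m * sReal (m + 1 + 2 * h)) -
      ((m + 1).choose (2 * h) * 2 ^ (200 - (m + 1 - 2 * h)) -
        (2 * h + m).choose m * sFix (m + 1 + 2 * h)) =
      -((2 * h + m).choose m * (2 ^ 200 * sReal (m + 1 + 2 * h) - sFix (m + 1 + 2 * h))) := by
    rw [← e3]; ring
  rw [e4, abs_neg, abs_of_nonneg (mul_nonneg (Nat.cast_nonneg _) hs.1)]
  have h1 : (((2 * h + m).choose m : ℕ) : ℝ) ≤ 2 ^ (2 * h + m) := by
    exact_mod_cast Nat.choose_le_two_pow _ _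
  have h2 : (2 : ℝ) ^ m ≤ 2 ^ 11 := pow_le_pow_right₀ one_le_two (by omega)
  calc _ ≤ (2 : ℝ) ^ (2 * h + m) * 50 := mul_le_mul h1 hs.2 hs.1 (by positivity)
    _ = 4 ^ h * (2 ^ m * 50) := by rw [pow_add, pow_mul]; norm_num; ring
    _ ≤ 4 ^ h * (2 ^ 11 * 50) := by gcongr
    _ ≤ _ := by
        rw [mul_comm]
        gcongr
        norm_num

/-- With `H = 30` and `m ≤ 11` the truncation errors, scaled by `2^200`, are `2^152 + 2^150`;
rounding adds only `30 * 2^18`. -/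
lemma abs_sum_dFix_mul_centralMoment_le {m : ℕ} (hm : m < 12) :
    |∑ h ∈ Finset.range 30, (dFix m h : ℝ) * centralMoment (2 * h)| ≤ 2 ^ 153 := by
  have h1 := abs_sum_coeff_mul_centralMoment_le (m := m) (H := 30) (by omega)
  have h2 : (1 / 2 : ℝ) ^ (2 * 30) * 2 ^ (m + 1) ≤ (1 / 2) ^ (2 * 30) * 2 ^ 12 := by
    gcongr
    · exact one_le_two
    · omega
  have e : ∑ h ∈ Finset.range 30, (dFix m h : ℝ) * centralMoment (2 * h) =
      2 ^ 200 * ∑ h ∈ Finset.range 30, ((m + 1).choose (2 * h) * (1 / 2) ^ (m + 1 - 2 * h) -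
      (2 * h + m).choose m * sReal (m + 1 + 2 * h)) * centralMoment (2 * h) -
      ∑ h ∈ Finset.range 30, (2 ^ 200 * ((m + 1).choose (2 * h) * (1 / 2) ^ (m + 1 - 2 * h) -
      (2 * h + m).choose m * sReal (m + 1 + 2 * h)) - dFix m h) * centralMoment (2 * h) := by
    rw [Finset.mul_sum, ← Finset.sum_sub_distrib]
    exact Finset.sum_congr rfl fun h _ => by ring
  have h3 : |∑ h ∈ Finset.range 30, (2 ^ 200 * ((m + 1).choose (2 * h) *
      (1 / 2) ^ (m + 1 - 2 * h) - (2 * h + m).choose m * sReal (m + 1 + 2 * h)) - dFix m h) *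
        centralMoment (2 * h)| ≤ 30 * 2 ^ 18 := by
    refine (Finset.abs_sum_le_sum_abs _ _).trans ?_
    refine (Finset.sum_le_sum (g := fun _ => (2 : ℝ) ^ 18) fun h _ => ?_).trans_eq (by simp)
    rw [abs_mul]
    calc _ ≤ 2 ^ 18 * 4 ^ h * |centralMoment (2 * h)| := by
          gcongr
          exact abs_dFix_sub_le hm h
      _ = 2 ^ 18 * (4 ^ h * |centralMoment (2 * h)|) := by ring
      _ ≤ 2 ^ 18 * 1 := by gcongr; exact four_pow_mul_abs_centralMoment_le h
      _ = _ := mul_one _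
  rw [e]
  refine (abs_sub _ _).trans ?_
  rw [abs_mul, abs_of_pos (by positivity)]
  have h4 : (2 : ℝ) ^ 200 * |∑ h ∈ Finset.range 30, ((m + 1).choose (2 * h) *
      (1 / 2) ^ (m + 1 - 2 * h) - (2 * h + m).choose m * sReal (m + 1 + 2 * h)) *
        centralMoment (2 * h)| ≤ 2 ^ 200 * ((1 / 2) ^ (2 * 30) * 2 ^ 12 + (1 / 2) ^ 50) := by
    gcongr
    exact h1.trans (by gcongr)
  calc _ ≤ (2 : ℝ) ^ 200 * ((1 / 2) ^ (2 * 30) * 2 ^ 12 + (1 / 2) ^ 50) + 30 * 2 ^ 18 := by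
        gcongr
    _ ≤ _ := by norm_num

lemma sum_abs_certCoeff_le : ∑ m ∈ Finset.range 12, |certCoeff m| ≤ 11 * 10 ^ 17 := by
  decide +kernel

/-- The residuals contribute `4 * 10^9` and the relations, with multipliers of total size `1.1 *
10^18`, less than `8 * 10^9`. The factor `10^6` matches the scale `10^18` of the multipliers to the
scale `10^24` of `coshCoeff`. -/
lemma abs_sum_coshCoeff_sub_le :
    |(∑ h ∈ Finset.range 30, (coshCoeff h : ℝ) * centralMoment (2 * h)) * 2 ^ 200 - residFix 0| ≤
      2 ^ 200 * (13 * 10 ^ 9) := by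
  have e : (∑ h ∈ Finset.range 30, (coshCoeff h : ℝ) * centralMoment (2 * h)) * 2 ^ 200 -
      residFix 0 = ∑ h ∈ Finset.range 29, (residFix (h + 1) : ℝ) * centralMoment (2 * (h + 1)) +
        10 ^ 6 * ∑ m ∈ Finset.range 12, (certCoeff m : ℝ) *
          ∑ h ∈ Finset.range 30, (dFix m h : ℝ) * centralMoment (2 * h) := by
    have h1 : ∑ h ∈ Finset.range 30, (residFix h : ℝ) * centralMoment (2 * h) =
        ∑ h ∈ Finset.range 29, (residFix (h + 1) : ℝ) * centralMoment (2 * (h + 1)) +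
          residFix 0 := by
      rw [Finset.sum_range_succ' _ 29, mul_zero, centralMoment_zero, mul_one]
    have h2 : ∑ m ∈ Finset.range 12, (certCoeff m : ℝ) *
        ∑ h ∈ Finset.range 30, (dFix m h : ℝ) * centralMoment (2 * h) =
        ∑ h ∈ Finset.range 30, (∑ m ∈ Finset.range 12, (certCoeff m : ℝ) * dFix m h) *
          centralMoment (2 * h) := by
      simp only [Finset.mul_sum, Finset.sum_mul]
      rw [Finset.sum_comm]
      exact Finset.sum_congr rfl fun h _ => Finset.sum_congr rfl fun m _ => by ring
    rw [h2, sub_eq_iff_eq_add, add_right_comm, ← h1, Finset.mul_sum, Finset.sum_mul,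
      ← Finset.sum_add_distrib]
    refine Finset.sum_congr rfl fun h _ => ?_
    rw [residFix]
    push_cast
    ring
  have h3 : |∑ h ∈ Finset.range 29, (residFix (h + 1) : ℝ) * centralMoment (2 * (h + 1))| ≤
      2 ^ 200 * 4 * 10 ^ 9 := by
    have hr : ((∑ h ∈ Finset.range 29, |residFix (h + 1)| * 4 ^ (28 - h) : ℤ) : ℝ) ≤
        ((4 ^ 29 * 2 ^ 200 * 4 * 10 ^ 9 : ℤ) : ℝ) := by exact_mod_cast sum_abs_residFix_le
    push_cast at hr
    refine (Finset.abs_sum_le_sum_abs _ _).trans ?_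
    have h4 : ∑ h ∈ Finset.range 29, |(residFix (h + 1) : ℝ) * centralMoment (2 * (h + 1))| ≤
        ∑ h ∈ Finset.range 29, |(residFix (h + 1) : ℝ)| * 4 ^ (28 - h) / 4 ^ 29 := by
      refine Finset.sum_le_sum fun h hh => ?_
      rw [Finset.mem_range] at hh
      have h5 := four_pow_mul_abs_centralMoment_le (h + 1)
      have h6 : (4 : ℝ) ^ 29 = 4 ^ (28 - h) * 4 ^ (h + 1) := by
        rw [← pow_add]; congr 1; omega
      have h7 : |centralMoment (2 * (h + 1))| ≤ 1 / 4 ^ (h + 1) := by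
        rw [le_div_iff₀ (by positivity), mul_comm]
        exact h5
      rw [abs_mul, h6]
      calc _ ≤ |(residFix (h + 1) : ℝ)| * (1 / 4 ^ (h + 1)) := by gcongr
        _ = _ := by field_simp
    refine h4.trans ?_
    rw [← Finset.sum_div, div_le_iff₀ (by positivity)]
    linarith
  have h7 : |∑ m ∈ Finset.range 12, (certCoeff m : ℝ) *
      ∑ h ∈ Finset.range 30, (dFix m h : ℝ) * centralMoment (2 * h)| ≤
        11 * 10 ^ 17 * 2 ^ 153 := by
    have hc : ((∑ m ∈ Finset.range 12, |certCoeff m| : ℤ) : ℝ) ≤ ((11 * 10 ^ 17 : ℤ) : ℝ) := by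
      exact_mod_cast sum_abs_certCoeff_le
    push_cast at hc
    refine (Finset.abs_sum_le_sum_abs _ _).trans ?_
    calc _ ≤ ∑ m ∈ Finset.range 12, |(certCoeff m : ℝ)| * 2 ^ 153 :=
          Finset.sum_le_sum fun m hm => by
            rw [abs_mul]
            gcongr
            exact abs_sum_dFix_mul_centralMoment_le (Finset.mem_range.1 hm)
      _ ≤ _ := by
          rw [← Finset.sum_mul]
          gcongr
          exact hc.trans (by norm_num)
  rw [e]
  refine (abs_add_le _ _).trans ?_
  rw [abs_mul, abs_of_pos (show (0 : ℝ) < 10 ^ 6 by positivity)]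
  calc _ ≤ (2 : ℝ) ^ 200 * 4 * 10 ^ 9 + 10 ^ 6 * (11 * 10 ^ 17 * 2 ^ 153) := by gcongr
    _ ≤ _ := by norm_num

/-! ### Numerical bounds for `log 2`, the exponential integral and `c0` -/

lemma log_two_bounds : 0.6931471805599453094 < Real.log 2 ∧ Real.log 2 < 0.6931471805599453095 := by
  have h := Real.hasSum_log_one_add_inv one_pos
  -- The tail after 24 terms of the series for `log 2` in odd powers of `1 / 3` is dominated by a
  -- geometric series of ratio `1 / 9`.
  have h' := (hasSum_nat_add_iff' 24).2 h
  have hg := (hasSum_geometric_of_lt_one (r := (1 / 9 : ℝ)) (by norm_num)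
    (by norm_num)).mul_left ((1 / 3) ^ 48)
  have h0 : ∀ k : ℕ, 0 ≤ (2 : ℝ) * (1 / (2 * ((k + 24 : ℕ) : ℝ) + 1)) *
      (1 / (2 * 1 + 1)) ^ (2 * (k + 24) + 1) := fun k => by positivity
  have h1 := h'.nonneg h0
  have h2 := hasSum_le (fun k => by
    have h3 : 2 * (1 / (2 * ((k + 24 : ℕ) : ℝ) + 1)) ≤ 1 / 20 := by
      have : (20 : ℝ) ≤ ((k + 24 : ℕ) : ℝ) := by push_cast; linarith [Nat.cast_nonneg (α := ℝ) k]
      rw [← mul_div_assoc, mul_one, div_le_div_iff₀ (by positivity) (by norm_num)]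
      linarith
    have h4 : ((1 : ℝ) / (2 * 1 + 1)) ^ (2 * (k + 24) + 1) =
        (1 / 3) * ((1 / 3) ^ 48 * (1 / 9) ^ k) := by
      rw [show (1 / 9 : ℝ) = (1 / 3) ^ 2 by norm_num, ← pow_mul, ← pow_add, ← pow_succ']
      norm_num
      ring_nf
    rw [h4]
    have h5 : (0 : ℝ) ≤ (1 / 3) ^ 48 * (1 / 9) ^ k := by positivity
    calc _ ≤ 1 / 20 * (1 / 3 * ((1 / 3 : ℝ) ^ 48 * (1 / 9) ^ k)) := by gcongr
      _ ≤ (1 / 3) ^ 48 * (1 / 9) ^ k := by linarith) h' hg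
  norm_num [Finset.sum_range_succ] at h1 h2
  constructor <;> linarith

/-- Centring at `1 / 2` makes the odd Taylor terms integrate to zero, so only the coefficients of
`cosh` survive. -/
lemma integral_two_rpow_muQ :
    ∫ x, (2 : ℝ) ^ x ∂muQ = √2 * ∫ x, Real.exp (Real.log 2 * (x - 1 / 2)) ∂muQ := by
  have e : ∀ x : ℝ, (2 : ℝ) ^ x = √2 * Real.exp (Real.log 2 * (x - 1 / 2)) := fun x => by
    rw [show √2 = Real.exp (Real.log 2 / 2) by rw [Real.exp_half, Real.exp_log two_pos],
      ← Real.exp_add, Real.rpow_def_of_pos two_pos]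
    ring_nf
  simp only [e, integral_const_mul]

lemma abs_integral_exp_sub_sum_le :
    |(∫ x, Real.exp (Real.log 2 * (x - 1 / 2)) ∂muQ) - ∑ h ∈ Finset.range 8,
      (Real.log 2 ^ (2 * h) / (2 * h).factorial) * centralMoment (2 * h)| ≤ 1 / 10 ^ 18 := by
  have hl := log_two_bounds
  refine abs_integral_sub_sum_centralMoment_le (integrable_muQ_of_continuous (by fun_prop))
    (fun i => Real.log 2 ^ i / i.factorial) 8 fun x _ hx => ?_
  have h1 : |Real.log 2 * (x - 1 / 2)| ≤ 1 / 2 := by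
    rw [abs_mul, abs_of_pos (by linarith)]
    nlinarith [abs_nonneg (x - 1 / 2)]
  have h2 := Real.exp_bound (h1.trans (by norm_num)) (n := 16) (by norm_num)
  have e : ∑ i ∈ Finset.range (2 * 8), Real.log 2 ^ i / i.factorial * (x - 1 / 2) ^ i =
      ∑ i ∈ Finset.range 16, (Real.log 2 * (x - 1 / 2)) ^ i / i.factorial :=
    Finset.sum_congr rfl fun i _ => by rw [mul_pow]; ring
  rw [e]
  refine h2.trans ?_
  calc _ ≤ (1 / 2 : ℝ) ^ 16 * ((16 : ℕ).succ / ((16 : ℕ).factorial * (16 : ℕ))) := by gcongr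
    _ ≤ _ := by norm_num [Nat.factorial]

lemma abs_log_two_pow_div_sub_le {h : ℕ} (hh : h < 8) :
    |Real.log 2 ^ (2 * h) / (2 * h).factorial - coshCoeff h / 10 ^ 24| ≤ 1 / 10 ^ 18 := by
  obtain ⟨h1, h2⟩ := log_two_bounds
  have h3 := pow_le_pow_left₀ (by norm_num) h1.le (2 * h)
  have h4 := pow_le_pow_left₀ (by linarith) h2.le (2 * h)
  have hf : (0 : ℝ) < (2 * h).factorial := by positivity
  have h5 := div_le_div_of_nonneg_right h3 hf.le
  have h6 := div_le_div_of_nonneg_right h4 hf.le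
  have h7 : -(1 / 10 ^ 18) ≤ (0.6931471805599453094 : ℝ) ^ (2 * h) / (2 * h).factorial -
      coshCoeff h / 10 ^ 24 := by
    interval_cases h <;> norm_num [coshCoeff, Nat.factorial]
  have h8 : (0.6931471805599453095 : ℝ) ^ (2 * h) / (2 * h).factorial -
      coshCoeff h / 10 ^ 24 ≤ 1 / 10 ^ 18 := by
    interval_cases h <;> norm_num [coshCoeff, Nat.factorial]
  rw [abs_le]
  constructor <;> linarith

lemma integral_exp_muQ_bounds :
    1.009861511403615 ≤ ∫ x, Real.exp (Real.log 2 * (x - 1 / 2)) ∂muQ ∧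
      ∫ x, Real.exp (Real.log 2 * (x - 1 / 2)) ∂muQ ≤ 1.009861511403642 := by
  have h1 := abs_integral_exp_sub_sum_le
  have h2 := abs_sum_coshCoeff_sub_le
  have h3 : ((10098615114036281544 * 10 ^ 5 * 2 ^ 200 : ℤ) : ℝ) ≤ residFix 0 ∧
      (residFix 0 : ℝ) ≤ ((10098615114036281545 * 10 ^ 5 * 2 ^ 200 : ℤ) : ℝ) :=
    ⟨by exact_mod_cast residFix_zero_mem.1, by exact_mod_cast residFix_zero_mem.2⟩
  push_cast at h3
  -- `coshCoeff` is `0` by default from `h = 8` on, so the certificate sum reduces to the eight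
  -- Taylor terms.
  have e : ∑ h ∈ Finset.range 30, (coshCoeff h : ℝ) * centralMoment (2 * h) =
      ∑ h ∈ Finset.range 8, (coshCoeff h : ℝ) * centralMoment (2 * h) := by
    refine (Finset.sum_subset (Finset.range_subset_range.2 (by norm_num)) fun h _ hh => ?_).symm
    rw [Finset.mem_range, not_lt] at hh
    rw [coshCoeff, List.getD_eq_default _ _ hh, Int.cast_zero, zero_mul]
  rw [e] at h2
  have h4 : |∑ h ∈ Finset.range 8, (Real.log 2 ^ (2 * h) / (2 * h).factorial) *
      centralMoment (2 * h) - (∑ h ∈ Finset.range 8, (coshCoeff h : ℝ) * centralMoment (2 * h)) /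
        10 ^ 24| ≤ 8 / 10 ^ 18 := by
    rw [Finset.sum_div, ← Finset.sum_sub_distrib]
    refine (Finset.abs_sum_le_sum_abs _ _).trans ?_
    refine (Finset.sum_le_sum (g := fun _ => (1 : ℝ) / 10 ^ 18) fun h hh => ?_).trans_eq ?_
    · rw [mul_div_right_comm, ← sub_mul, abs_mul]
      have h5 : |centralMoment (2 * h)| ≤ 1 :=
        (abs_centralMoment_le _).trans (pow_le_one₀ (by norm_num) (by norm_num))
      exact (mul_le_of_le_one_right (abs_nonneg _) h5).trans
        (abs_log_two_pow_div_sub_le (Finset.mem_range.1 hh))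
    · simp
      norm_num
  set S := ∑ h ∈ Finset.range 8, (coshCoeff h : ℝ) * centralMoment (2 * h)
  rw [abs_le] at h1 h2 h4
  have h5 : 10098615114036281544 * 10 ^ 5 - 13 * 10 ^ 9 ≤ S := by
    have := h2.1
    have := h3.1
    norm_num at *
    linarith
  have h6 : S ≤ 10098615114036281545 * 10 ^ 5 + 13 * 10 ^ 9 := by
    have := h2.2
    have := h3.2
    norm_num at *
    linarith
  norm_num at *
  constructor <;> linarith

lemma c0_bounds : 1.030199563382 ≤ c0 ∧ c0 < 1.030199563383 := by
  have h := log_two_mul_c0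
  rw [integral_two_rpow_muQ] at h
  obtain ⟨h1, h2⟩ := integral_exp_muQ_bounds
  obtain ⟨l1, l2⟩ := log_two_bounds
  have s1 : 1.41421356237309504 ≤ √2 := Real.le_sqrt_of_sq_le (by norm_num)
  have s2 : √2 ≤ 1.41421356237309505 := (Real.sqrt_le_left (by norm_num)).2 (by norm_num)
  set E := ∫ x, Real.exp (Real.log 2 * (x - 1 / 2)) ∂muQ
  have h3 : 1.41421356237309504 * 1.009861511403615 ≤ √2 * E := by gcongr
  have h4 : √2 * E ≤ 1.41421356237309505 * 1.009861511403642 := by gcongr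
  constructor
  · by_contra! hc
    have : Real.log 2 * c0 < 0.6931471805599453095 * 1.030199563382 := by nlinarith
    norm_num at *
    linarith
  · by_contra! hc
    have : 0.6931471805599453094 * 1.030199563383 ≤ Real.log 2 * c0 := by gcongr
    norm_num at *
    linarith

end Minkowski

end

theorem theorem1 :
    -- the three expressions for the moments agree
    (∀ L : ℕ,
      ∫ x in Set.Ici (0 : ℝ), (x / (x + 1)) ^ L ∂Minkowski.measureF = Minkowski.moment L ∧
      2 * ∫ x in Set.Icc (0 : ℝ) 1, x ^ L ∂Minkowski.measureF = Minkowski.moment L) ∧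
    -- periodicity of `Ψ`
    (∀ x : ℝ, 0 ≤ x → Minkowski.Psi (x + 1) = Minkowski.Psi x) ∧
    -- `Ψ` is integrable, and `c_0 = ∫_0^1 Ψ(x) dx = 1.030199563382...`
    IntervalIntegrable Minkowski.Psi volume 0 1 ∧
    (1.030199563382 ≤ Minkowski.c0 ∧ Minkowski.c0 < 1.030199563383) ∧
    -- the asymptotic formula
    (fun L : ℕ => Minkowski.moment L -
        (4 * Real.pi ^ 2 * Real.log 2) ^ (1 / 4 : ℝ) * Minkowski.c0 * (L : ℝ) ^ (1 / 4 : ℝ) *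
          Minkowski.C ^ √(L : ℝ))
      =O[atTop] (fun L : ℕ => (L : ℝ) ^ (-1 / 4 : ℝ) * Minkowski.C ^ √(L : ℝ)) := by
  exact ⟨fun L => ⟨Minkowski.setIntegral_Ici_eq_moment L,
      Minkowski.two_mul_setIntegral_Icc_eq_moment L⟩,
    fun _ hx => Minkowski.Psi_add_one hx, Minkowski.continuous_Psi.intervalIntegrable 0 1,
    Minkowski.c0_bounds, Minkowski.moment_asymptotics⟩
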